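/- Let $d\ge 2$ and $\alpha>0$, and write $\Omega_0=(0,1)^d$, $\tilde\Omega_0=(-3,4)^d$. There exist constants $C=C(\alpha,d)$ and $\beta=\beta(\alpha,d)$, depending only on $\alpha$ and $d$, such that for every $\bar\theta\in H^1_{loc}(\mathbb R^d)$ there is a vector field $u:\mathbb R^d\times[0,\infty)\to\mathbb R^d$ (depending on $\bar\theta$) with the following properties. The field $u$ is piecewise constant in time (there are times $0=\tau_0<\tau_1<\cdots\to\infty$ such that $u$ is independent of time on each $[\tau_k,\tau_{k+1})$). For every $t\ge 0$ the field $u(\cdot,t)$ is $C^1$, divergence-free and has its (closed) support contained in $\tilde\Omega_0$, and $$\sup_{0\le t<\infty}\|u(\cdot,t)\|_{C^1(\mathbb R^d)}\le C,$$ where $\|v\|_{C^1(\mathbb R^d)}=\sup|v|+\sup|Dv|$. The transport equation $$\partial_t\theta+u\cdot\nabla\theta=0\quad\text{in }\mathbb R^d\times[0,\infty),\qquad \theta(\cdot,0)=\bar\theta,$$ has a unique weak solution $\theta$ in $L^\infty([0,\infty);L^2_{loc}(\mathbb R^d))$. This solution has a representative in $C([0,\infty);L^2_{loc}(\mathbb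 R^d))$, again denoted $\theta$, such that $\theta(\cdot,t)\in H^1_{loc}(\mathbb R^d)$ for every $t\ge 0$, and: 1. for all integers $n\ge 0$, $$\|\nabla\theta(\cdot,n)\|_{L^2(\Omega_0)}\ge e^{\alpha n}\,\|\nabla\bar\theta\|_{L^2(\Omega_0)};$$ 2. for all real $t\ge 0$, $$\|\nabla\theta(\cdot,t)\|_{L^2(\tilde\Omega_0)}\ge e^{\alpha t-\beta}\,\|\nabla\bar\theta\|_{L^2(\Omega_0)}.$$ Here a weak solution $\theta\in L^\infty([0,\infty);L^2_{loc}(\mathbb R^d))$ with initial data $\bar\theta$ is one satisfying $\int_0^\infty\int_{\mathbb R^d}\theta\,(\partial_t\psi+u\cdot\nabla\psi)\,dx\,dt+\int_{\mathbb R^d}\bar\theta\,\psi(\cdot,0)\,dx=0$ for all $\psi\in C_c^\infty(\mathbb R^d\times[0,\infty))$, and $\nabla$ of an $H^1_{loc}$ function is its weak gradient. -/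

import Mathlib

open MeasureTheory Set Filter Topology
open scoped NNReal ENNReal ContDiff

noncomputable section

/-- The open cube `(a, b)^d` in `ℝ^d`. -/
def openCube (d : ℕ) (a b : ℝ) : Set (EuclideanSpace ℝ (Fin d)) :=
  {x | ∀ i, x i ∈ Ioo a b}

/-- `f ∈ L²_loc(ℝ^d)`: `f` is square integrable on every compact set. -/
def MemL2loc {d : ℕ} {F : Type*} [NormedAddCommGroup F]
    (f : EuclideanSpace ℝ (Fin d) → F) : Prop :=
  ∀ K : Set (EuclideanSpace ℝ (Fin d)), IsCompact K → MemLp f 2 (volume.restrict K)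

/-- `g` is a weak (distributional) gradient of `f` on `ℝ^d`:
`∫ f ∂ᵢφ = - ∫ φ gᵢ` for every `φ ∈ C_c^∞(ℝ^d)` and every coordinate `i`. -/
def HasWeakGradient {d : ℕ} (f : EuclideanSpace ℝ (Fin d) → ℝ)
    (g : EuclideanSpace ℝ (Fin d) → EuclideanSpace ℝ (Fin d)) : Prop :=
  ∀ φ : EuclideanSpace ℝ (Fin d) → ℝ, ContDiff ℝ ∞ φ → HasCompactSupport φ →
    ∀ i : Fin d,
      ∫ x, f x * fderiv ℝ φ x (EuclideanSpace.single i 1) = - ∫ x, φ x * g x i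

/-- `f ∈ H¹_loc(ℝ^d)`: `f` is in `L²_loc` and has a weak gradient in `L²_loc`. -/
def MemH1loc {d : ℕ} (f : EuclideanSpace ℝ (Fin d) → ℝ) : Prop :=
  MemL2loc f ∧
    ∃ g : EuclideanSpace ℝ (Fin d) → EuclideanSpace ℝ (Fin d), MemL2loc g ∧ HasWeakGradient f g

open Classical in
/-- The weak gradient `∇f` of `f ∈ H¹_loc(ℝ^d)` (which is determined almost everywhere), with the
value `0` if `f` is not in `H¹_loc(ℝ^d)`. -/
def weakGrad {d : ℕ} (f : EuclideanSpace ℝ (Fin d) → ℝ) :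
    EuclideanSpace ℝ (Fin d) → EuclideanSpace ℝ (Fin d) :=
  if h : MemH1loc f then h.2.choose else 0

/-- `‖∇f‖_{L²(Ω)}` for `f ∈ H¹_loc(ℝ^d)`. -/
def gradL2Norm {d : ℕ} (f : EuclideanSpace ℝ (Fin d) → ℝ)
    (Ω : Set (EuclideanSpace ℝ (Fin d))) : ℝ≥0∞ :=
  eLpNorm (weakGrad f) 2 (volume.restrict Ω)

/-- The norm `‖v‖_{C¹(ℝ^d)} = sup |v| + sup |Dv|` (for differentiable `v`). -/
def C1Norm {d : ℕ} (v : EuclideanSpace ℝ (Fin d) → EuclideanSpace ℝ (Fin d)) : ℝ≥0∞ :=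
  (⨆ x, ‖v x‖ₑ) + ⨆ x, ‖fderiv ℝ v x‖ₑ

/-- The (differentiable) vector field `v` has zero divergence: `∑ᵢ ∂ᵢ vᵢ = 0` everywhere. -/
def IsDivFree {d : ℕ} (v : EuclideanSpace ℝ (Fin d) → EuclideanSpace ℝ (Fin d)) : Prop :=
  ∀ x, ∑ i : Fin d, fderiv ℝ v x (EuclideanSpace.single i 1) i = 0

/-- The time-dependent vector field `u` is piecewise constant in time on `[0, ∞)`: there are times
`0 = τ₀ < τ₁ < τ₂ < … → ∞` such that `u` does not depend on time on each `[τₖ, τₖ₊₁)`. -/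
def IsPiecewiseConstantInTime {d : ℕ}
    (u : ℝ → EuclideanSpace ℝ (Fin d) → EuclideanSpace ℝ (Fin d)) : Prop :=
  ∃ τ : ℕ → ℝ, τ 0 = 0 ∧ StrictMono τ ∧ Tendsto τ atTop atTop ∧
    ∀ k, ∀ t ∈ Ico (τ k) (τ (k + 1)), u t = u (τ k)

/-- `θ` is a weak solution, in the class `L^∞([0, ∞); L²_loc(ℝ^d))`, of the transport equation
`∂ₜθ + u · ∇θ = 0` on `ℝ^d × [0, ∞)` with initial data `θ₀`, for a divergence-free field `u`.
The weak formulation is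
`∫_0^∞ ∫ θ (∂ₜψ + u · ∇ψ) dx dt + ∫ θ₀ ψ(0, ·) dx = 0` for all `ψ ∈ C_c^∞([0, ∞) × ℝ^d)`;
here `∂ₜψ + u · ∇ψ` is the derivative of `ψ` in the direction `(1, u)`. -/
structure IsWeakTransportSolution {d : ℕ}
    (u : ℝ → EuclideanSpace ℝ (Fin d) → EuclideanSpace ℝ (Fin d))
    (θ₀ : EuclideanSpace ℝ (Fin d) → ℝ) (θ : ℝ → EuclideanSpace ℝ (Fin d) → ℝ) : Prop where
  aestronglyMeasurable :
    AEStronglyMeasurable (fun p : ℝ × EuclideanSpace ℝ (Fin d) => θ p.1 p.2)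
      (volume.restrict (Ici (0 : ℝ) ×ˢ univ))
  bounded : ∀ K : Set (EuclideanSpace ℝ (Fin d)), IsCompact K →
    ∃ M : ℝ≥0, ∀ᵐ t ∂(volume.restrict (Ici (0 : ℝ))), eLpNorm (θ t) 2 (volume.restrict K) ≤ M
  weak_eq : ∀ ψ : ℝ × EuclideanSpace ℝ (Fin d) → ℝ, ContDiff ℝ ∞ ψ → HasCompactSupport ψ →
    (∫ p in Ici (0 : ℝ) ×ˢ univ, θ p.1 p.2 * fderiv ℝ ψ p ((1 : ℝ), u p.1 p.2))
      + ∫ x, θ₀ x * ψ (0, x) = 0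

/-- `θ ∈ C([0, ∞); L²_loc(ℝ^d))`. -/
def IsContinuousInL2loc {d : ℕ} (θ : ℝ → EuclideanSpace ℝ (Fin d) → ℝ) : Prop :=
  (∀ t ∈ Ici (0 : ℝ), MemL2loc (θ t)) ∧
    ∀ K : Set (EuclideanSpace ℝ (Fin d)), IsCompact K → ∀ t ∈ Ici (0 : ℝ),
      Tendsto (fun s => eLpNorm (θ s - θ t) 2 (volume.restrict K)) (𝓝[Ici 0] t) (𝓝 0)

end

/-!
The velocity is built from *swirls*: fields `F(x) J(x - c)`, where `J` generates the rotations of a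
coordinate plane and `F` is invariant under these rotations about `c`. The flow of a swirl turns
each point `x` about `c` by the angle `t F(x)`, so it is explicit, smooth and global. It preserves
volume because its derivative is a rotation composed with the transvection
`1 + t (J z) ⊗ ∇F`, `z = x - c`, and `∇F ⊥ J z`.

*Growth.* Let `F` be close to `π + (1/16) sin (N |J z|² + φ)` near the cube. At time one the
swirl sends a small piece of the unit cube near `p` to a neighbourhood of the reflected point
`2c - p`, which for a suitable `c` lies well inside the cube, so no gradient is lost through the
boundary. A gradient `g` becomes, up to a rotation, `g - ⟪g, J z⟫ ∇F` with `∇F` of size `N`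
(`Swirl.norm_adjoint_fderiv_flow`). The zeros of the cosine in `∇F` and of `⟪g, J z⟫` are removed
by summing over four phases `φ`, four centres and all coordinate planes
(`sum_norm_sq_cubeSwirl`): the sum of the squared lengths of the new gradients is at least
`N² 2⁻¹⁵ |g|²`. After integration over a finite cover of the cube, one member of a fixed finite
family of swirls multiplies the norm of the gradient on the cube by `e^α`, once `N` is large
(`exists_swirl_family`). That member is used during `[n, n + 1)`, and the choice is repeated
with the solution at time `n + 1`. As the family is finite, the `C¹` bound is uniform. At
intermediate times, the gradient norm on the large cube, which the flow maps onto itself, has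
decreased at most by the Lipschitz constant of the flow (`gradL2Norm_le_comp`).

*Well-posedness.* The solution is the datum composed with the backward flow. Existence and uniqueness
are proved on one slab `[n, n + 1) × ℝ^d` at a time, where the field is smooth and autonomous: in
the coordinates that follow the flow the material derivative is `∂ₜ`
(`VolumePreservingFlow.fderiv_comp_spacetime`), and test functions stay test functions. On each slab
the difference of two solutions is then orthogonal to every `∂ₜχ`, hence zero
(`VolumePreservingFlow.ae_eq_zero_on_slab`). Weak gradients are transported through the
chain rule, which rests on Piola's identity (`VolumePreservingDiffeo.isDivFree_fderiv`).
-/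

/-! ### Rotations and swirls -/

/-- A smooth autonomous vector field on `ℝ^d` together with its flow, which is assumed to be
global, jointly smooth and volume preserving. -/
structure VolumePreservingFlow (d : ℕ) where
  field : EuclideanSpace ℝ (Fin d) → EuclideanSpace ℝ (Fin d)
  flow : ℝ → EuclideanSpace ℝ (Fin d) → EuclideanSpace ℝ (Fin d)
  contDiff_field : ContDiff ℝ ∞ field
  contDiff_flow : ContDiff ℝ ∞ fun p : ℝ × EuclideanSpace ℝ (Fin d) => flow p.1 p.2
  flow_zero : ∀ x, flow 0 x = x
  flow_add : ∀ s t x, flow (s + t) x = flow s (flow t x)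
  hasDerivAt_flow : ∀ t x, HasDerivAt (fun s => flow s x) (field (flow t x)) t
  measurePreserving_flow : ∀ t, MeasurePreserving (flow t) volume volume

section Rotation

variable {E : Type*} [NormedAddCommGroup E] [InnerProductSpace ℝ E]

/-- `J` generates a rotation group with period `2π`: it is skew-symmetric and `J³ = -J`, so that
`-J²` is an orthogonal projection on whose range `J` is a complex structure. -/
structure IsRotationGenerator (J : E →L[ℝ] E) : Prop where
  skew : ∀ x y, inner ℝ (J x) y = -inner ℝ x (J y)
  cube : ∀ x, J (J (J x)) = -J x

/-- The rotation `exp (a J) = 1 + sin a J + (1 - cos a) J²` (Rodrigues' formula). -/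
noncomputable def rodrigues (J : E →L[ℝ] E) (a : ℝ) : E →L[ℝ] E :=
  ContinuousLinearMap.id ℝ E + Real.sin a • J + (1 - Real.cos a) • (J.comp J)

variable {J : E →L[ℝ] E}

lemma rodrigues_apply (a : ℝ) (x : E) :
    rodrigues J a x = x + Real.sin a • J x + (1 - Real.cos a) • J (J x) := by
  simp [rodrigues]

lemma rodrigues_zero (x : E) : rodrigues J 0 x = x := by
  simp [rodrigues_apply]

lemma map_rodrigues (a : ℝ) (x : E) : J (rodrigues J a x) = rodrigues J a (J x) := by
  simp [rodrigues_apply]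

namespace IsRotationGenerator

lemma inner_self (hJ : IsRotationGenerator J) (x : E) : inner ℝ (J x) x = 0 := by
  have h := hJ.skew x x
  rw [real_inner_comm x (J x)] at h
  rw [real_inner_comm] ; linarith

lemma rodrigues_add (hJ : IsRotationGenerator J) (a b : ℝ) (x : E) :
    rodrigues J (a + b) x = rodrigues J a (rodrigues J b x) := by
  simp only [rodrigues_apply, map_add, map_smul, hJ.cube, Real.sin_add, Real.cos_add, map_neg]
  module

lemma inner_rodrigues (hJ : IsRotationGenerator J) (a : ℝ) (x y : E) :
    inner ℝ (rodrigues J a x) y = inner ℝ x (rodrigues J (-a) y) := by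
  simp only [rodrigues_apply, inner_add_left, inner_add_right, inner_smul_left, inner_smul_right,
    hJ.skew, Real.sin_neg, Real.cos_neg]
  simp

lemma inner_rodrigues_rodrigues (hJ : IsRotationGenerator J) (a : ℝ) (x y : E) :
    inner ℝ (rodrigues J a x) (rodrigues J a y) = inner ℝ x y := by
  rw [hJ.inner_rodrigues, ← hJ.rodrigues_add]; simp [rodrigues_zero]

lemma norm_rodrigues (hJ : IsRotationGenerator J) (a : ℝ) (x : E) : ‖rodrigues J a x‖ = ‖x‖ := by
  have h := hJ.inner_rodrigues_rodrigues a x x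
  rw [real_inner_self_eq_norm_sq, real_inner_self_eq_norm_sq] at h
  exact (sq_eq_sq₀ (norm_nonneg _) (norm_nonneg _)).1 h

lemma add_sq_rodrigues (hJ : IsRotationGenerator J) (a : ℝ) (x : E) :
    rodrigues J a x + J (J (rodrigues J a x)) = x + J (J x) := by
  simp only [rodrigues_apply, map_add, map_smul, hJ.cube, map_neg]
  module

lemma hasDerivAt_rodrigues (hJ : IsRotationGenerator J) (a : ℝ) (x : E) :
    HasDerivAt (fun a => rodrigues J a x) (J (rodrigues J a x)) a := by
  simp only [rodrigues_apply, map_add, map_smul, hJ.cube]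
  have := (((Real.hasDerivAt_sin a).smul_const (J x)).const_add x).add
    (((Real.hasDerivAt_cos a).const_sub 1).smul_const (J (J x)))
  refine this.congr_deriv ?_
  module

lemma sq_inner (hJ : IsRotationGenerator J) (x y : E) :
    inner ℝ (J x) (J y) = -inner ℝ (J (J x)) y := by
  rw [hJ.skew (J x) y]; ring

end IsRotationGenerator

lemma contDiff_rodrigues {G : Type*} [NormedAddCommGroup G] [NormedSpace ℝ G] {a : G → ℝ}
    {z : G → E} {n : WithTop ℕ∞} (ha : ContDiff ℝ n a) (hz : ContDiff ℝ n z) :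
    ContDiff ℝ n fun p => rodrigues J (a p) (z p) := by
  simp only [rodrigues_apply]
  have h1 : ContDiff ℝ n fun p => Real.sin (a p) := Real.contDiff_sin.comp ha
  have h2 : ContDiff ℝ n fun p => Real.cos (a p) := Real.contDiff_cos.comp ha
  fun_prop

lemma hasFDerivAt_rodrigues {G : Type*} [NormedAddCommGroup G] [NormedSpace ℝ G]
    (hJ : IsRotationGenerator J) {a : G → ℝ} {a' : G →L[ℝ] ℝ} {z : G → E} {z' : G →L[ℝ] E} {p : G}
    (ha : HasFDerivAt a a' p) (hz : HasFDerivAt z z' p) :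
    HasFDerivAt (fun p => rodrigues J (a p) (z p))
      ((rodrigues J (a p)).comp (z' + a'.smulRight (J (z p)))) p := by
  simp only [rodrigues_apply]
  have h1 := (Real.hasDerivAt_sin (a p)).comp_hasFDerivAt p ha
  have h2 := ((Real.hasDerivAt_cos (a p)).comp_hasFDerivAt p ha).const_sub 1
  have hJz := J.hasFDerivAt.comp p hz
  have hJJz := J.hasFDerivAt.comp p hJz
  have := (hz.add (h1.smul hJz)).add (h2.smul hJJz)
  refine this.congr_fderiv ?_
  ext v
  simp [rodrigues_apply, hJ.cube]
  module

end Rotation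

section Swirl

variable {d : ℕ}

local notation "E" => EuclideanSpace ℝ (Fin d)

/-- The data of a swirl: a rotation generator `J`, a centre `c` and a smooth angular velocity `F`
which is invariant under the rotations `exp (a J)` about `c`. -/
structure Swirl (d : ℕ) where
  gen : EuclideanSpace ℝ (Fin d) →L[ℝ] EuclideanSpace ℝ (Fin d)
  center : EuclideanSpace ℝ (Fin d)
  speed : EuclideanSpace ℝ (Fin d) → ℝ
  isGen : IsRotationGenerator gen
  contDiff_speed : ContDiff ℝ ∞ speed
  speed_rot : ∀ a z, speed (center + rodrigues gen a z) = speed (center + z)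

namespace Swirl

variable (S : Swirl d)

/-- The field `F(x) J(x - c)` of a swirl. -/
def field (x : E) : E := S.speed x • S.gen (x - S.center)

/-- The flow of a swirl: at time `t`, the point `x` is turned about `c` by the angle `t F(x)`. -/
noncomputable def flow (t : ℝ) (x : E) : E :=
  S.center + rodrigues S.gen (t * S.speed x) (x - S.center)

lemma speed_flow (t : ℝ) (x : E) : S.speed (S.flow t x) = S.speed x := by
  rw [flow, S.speed_rot, add_sub_cancel]

lemma flow_sub_center (t : ℝ) (x : E) :
    S.flow t x - S.center = rodrigues S.gen (t * S.speed x) (x - S.center) := by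
  simp [flow]

lemma flow_zero (x : E) : S.flow 0 x = x := by
  simp [flow, rodrigues_zero]

lemma flow_add (s t : ℝ) (x : E) : S.flow (s + t) x = S.flow s (S.flow t x) := by
  conv_rhs => rw [flow, speed_flow, flow_sub_center, ← S.isGen.rodrigues_add, ← add_mul]
  rfl

lemma flow_neg_flow (t : ℝ) (x : E) : S.flow (-t) (S.flow t x) = x := by
  rw [← flow_add, neg_add_cancel, flow_zero]

lemma flow_of_speed_eq_zero {x : E} (h : S.speed x = 0) (t : ℝ) : S.flow t x = x := by
  simp [flow, h, rodrigues_zero]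

lemma contDiff_field : ContDiff ℝ ∞ S.field := by
  have := S.contDiff_speed
  unfold field
  fun_prop

lemma contDiff_flow : ContDiff ℝ ∞ fun p : ℝ × E => S.flow p.1 p.2 := by
  have := S.contDiff_speed
  unfold flow
  exact contDiff_const.add (contDiff_rodrigues (by fun_prop) (by fun_prop))

lemma hasDerivAt_flow (t : ℝ) (x : E) :
    HasDerivAt (fun s => S.flow s x) (S.field (S.flow t x)) t := by
  have h := (S.isGen.hasDerivAt_rodrigues (t * S.speed x) (x - S.center)).scomp t
    ((hasDerivAt_id t).mul_const (S.speed x))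
  rw [field, speed_flow, flow_sub_center]
  simpa [flow, Function.comp_def] using h.const_add S.center

lemma hasFDerivAt_speed (x : E) : HasFDerivAt S.speed (fderiv ℝ S.speed x) x :=
  (S.contDiff_speed.differentiable (by simp) x).hasFDerivAt

/-- Invariance of the angular velocity, in infinitesimal form. -/
lemma fderiv_speed_gen (x : E) : fderiv ℝ S.speed x (S.gen (x - S.center)) = 0 := by
  have h := (S.isGen.hasDerivAt_rodrigues 0 (x - S.center)).const_add S.center
  have h' : HasFDerivAt S.speed (fderiv ℝ S.speed x)
      (S.center + rodrigues S.gen 0 (x - S.center)) := by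
    simpa [rodrigues_zero] using S.hasFDerivAt_speed x
  have h2 := h'.comp_hasDerivAt 0 h
  have h3 : S.speed ∘ (fun a => S.center + rodrigues S.gen a (x - S.center))
      = fun _ => S.speed x := by
    ext a; simp only [Function.comp_apply, S.speed_rot, add_sub_cancel]
  rw [h3] at h2
  simp only [rodrigues_zero] at h2
  exact h2.unique (hasDerivAt_const (0 : ℝ) (S.speed x))

lemma hasFDerivAt_flow (t : ℝ) (x : E) :
    HasFDerivAt (S.flow t) ((rodrigues S.gen (t * S.speed x)).comp
      (ContinuousLinearMap.id ℝ E +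
        (t • fderiv ℝ S.speed x).smulRight (S.gen (x - S.center)))) x :=
  (hasFDerivAt_rodrigues S.isGen ((S.hasFDerivAt_speed x).const_mul t)
    ((hasFDerivAt_id x).sub_const S.center)).const_add S.center

lemma abs_det_flow (t : ℝ) (x : E) : |(fderiv ℝ (S.flow t) x).det| = 1 := by
  rw [(S.hasFDerivAt_flow t x).fderiv]
  have h1 : |(rodrigues S.gen (t * S.speed x)).det| = 1 := by
    let L : E →ₗᵢ[ℝ] E := ⟨(rodrigues S.gen (t * S.speed x)).toLinearMap,
      fun y => S.isGen.norm_rodrigues _ y⟩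
    have h := L.normDet_eq_one
    rwa [LinearMap.normDet_eq_abs_det] at h
  have h2 : (ContinuousLinearMap.id ℝ E +
        (t • fderiv ℝ S.speed x).smulRight (S.gen (x - S.center))).det = 1 := by
    have h3 : ((ContinuousLinearMap.id ℝ E +
        (t • fderiv ℝ S.speed x).smulRight (S.gen (x - S.center)) : E →L[ℝ] E) : E →ₗ[ℝ] E) =
        LinearMap.transvection ((t • fderiv ℝ S.speed x : E →L[ℝ] ℝ) : E →ₗ[ℝ] ℝ)
          (S.gen (x - S.center)) := by
      ext v; simp [LinearMap.transvection.apply]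
    rw [ContinuousLinearMap.det, h3, LinearMap.transvection.det, ContinuousLinearMap.coe_coe,
      _root_.smul_apply, S.fderiv_speed_gen]
    simp
  rw [ContinuousLinearMap.det] at h1 h2 ⊢
  rw [ContinuousLinearMap.toLinearMap_comp, LinearMap.det_comp, abs_mul, h1, h2]
  simp

lemma measurePreserving_flow (t : ℝ) : MeasurePreserving (S.flow t) volume volume := by
  have hc : Continuous (S.flow t) :=
    continuous_iff_continuousAt.2 fun x => (S.hasFDerivAt_flow t x).continuousAt
  have hinj : Function.Injective (S.flow t) :=
    Function.LeftInverse.injective (S.flow_neg_flow t)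
  refine ⟨hc.measurable, ?_⟩
  ext s hs
  rw [Measure.map_apply hc.measurable hs]
  have himg : S.flow t '' (S.flow t ⁻¹' s) = s := by
    rw [image_preimage_eq]
    intro y
    exact ⟨S.flow (-t) y, by simpa using S.flow_neg_flow (-t) y⟩
  have := lintegral_abs_det_fderiv_eq_addHaar_image volume (hc.measurable hs)
    (f := S.flow t) (f' := fderiv ℝ (S.flow t))
    (fun x _ => (S.hasFDerivAt_flow t x).differentiableAt.hasFDerivAt.hasFDerivWithinAt) hinj.injOn
  rw [himg] at this
  simp_rw [← this, S.abs_det_flow]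
  simp

/-- A swirl, seen as a volume preserving flow. -/
noncomputable def toFlow : VolumePreservingFlow d where
  field := S.field
  flow := S.flow
  contDiff_field := S.contDiff_field
  contDiff_flow := S.contDiff_flow
  flow_zero := S.flow_zero
  flow_add := S.flow_add
  hasDerivAt_flow := S.hasDerivAt_flow
  measurePreserving_flow := S.measurePreserving_flow

lemma isDivFree_field : IsDivFree S.field := by
  intro x
  have h : HasFDerivAt S.field (S.speed x • S.gen +
      (fderiv ℝ S.speed x).smulRight (S.gen (x - S.center))) x := by
    have := (S.hasFDerivAt_speed x).smul
      (S.gen.hasFDerivAt.comp x ((hasFDerivAt_id x).sub_const S.center))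
    exact this
  rw [h.fderiv]
  have h1 : ∀ i : Fin d, S.gen (EuclideanSpace.single i 1) i = 0 := fun i => by
    have := S.isGen.inner_self (EuclideanSpace.single i (1 : ℝ))
    simpa [EuclideanSpace.inner_single_right] using this
  have h2 : ∑ i : Fin d, (S.gen (x - S.center)) i • EuclideanSpace.single i (1 : ℝ)
      = S.gen (x - S.center) := by
    simpa using (EuclideanSpace.basisFun (Fin d) ℝ).sum_repr (S.gen (x - S.center))
  calc _ = ∑ i : Fin d, fderiv ℝ S.speed x
        ((S.gen (x - S.center)) i • EuclideanSpace.single i (1 : ℝ)) := by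
        refine Finset.sum_congr rfl fun i _ => ?_
        simp [h1, mul_comm]
    _ = 0 := by rw [← map_sum, h2, fderiv_speed_gen]

end Swirl
end Swirl

/-! ### Weak gradients and volume preserving diffeomorphisms -/

section WeakGradient

variable {d : ℕ}

local notation "E" => EuclideanSpace ℝ (Fin d)

/-- A smooth volume preserving diffeomorphism of `ℝ^d`. -/
structure VolumePreservingDiffeo (d : ℕ) where
  toHomeo : EuclideanSpace ℝ (Fin d) ≃ₜ EuclideanSpace ℝ (Fin d)
  contDiff : ContDiff ℝ ∞ toHomeo
  contDiff_symm : ContDiff ℝ ∞ toHomeo.symm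
  measurePreserving : MeasurePreserving toHomeo volume volume

namespace VolumePreservingDiffeo

variable (e : VolumePreservingDiffeo d)

lemma integral_comp {G : Type*} [NormedAddCommGroup G] [NormedSpace ℝ G] (h : E → G) :
    ∫ x, h (e.toHomeo x) = ∫ x, h x :=
  e.measurePreserving.integral_comp e.toHomeo.measurableEmbedding h

/-- The measure-preserving property, localised to a set and its image. -/
lemma measurePreserving_restrict (s : Set E) :
    MeasurePreserving e.toHomeo (volume.restrict s) (volume.restrict (e.toHomeo '' s)) := by
  have := e.measurePreserving.restrict_preimage_emb e.toHomeo.measurableEmbedding (e.toHomeo '' s)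
  rwa [preimage_image_eq _ e.toHomeo.injective] at this

lemma differentiable : Differentiable ℝ e.toHomeo := e.contDiff.differentiable (by simp)

lemma fderiv_symm_comp (x v : E) :
    fderiv ℝ e.toHomeo.symm (e.toHomeo x) (fderiv ℝ e.toHomeo x v) = v := by
  have h1 : HasFDerivAt e.toHomeo.symm (fderiv ℝ e.toHomeo.symm (e.toHomeo x)) (e.toHomeo x) :=
    (e.contDiff_symm.differentiable (by simp) _).hasFDerivAt
  have h2 := h1.comp x (e.differentiable x).hasFDerivAt
  have h3 : e.toHomeo.symm ∘ e.toHomeo = id := by ext y : 1; simp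
  rw [h3] at h2
  have := DFunLike.congr_fun (h2.unique (hasFDerivAt_id x)) v
  simpa using this

lemma fderiv_comp_symm (y v : E) :
    fderiv ℝ e.toHomeo (e.toHomeo.symm y) (fderiv ℝ e.toHomeo.symm y v) = v := by
  have h1 : HasFDerivAt e.toHomeo (fderiv ℝ e.toHomeo (e.toHomeo.symm y)) (e.toHomeo.symm y) :=
    (e.differentiable _).hasFDerivAt
  have h2 := h1.comp y (e.contDiff_symm.differentiable (by simp) y).hasFDerivAt
  have h3 : e.toHomeo ∘ e.toHomeo.symm = id := by ext y : 1; simp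
  rw [h3] at h2
  have := DFunLike.congr_fun (h2.unique (hasFDerivAt_id y)) v
  simpa using this

end VolumePreservingDiffeo

lemma EuclideanSpace.sum_apply_smul_single (v : E) :
    ∑ i : Fin d, v i • EuclideanSpace.single i (1 : ℝ) = v := by
  simpa using (EuclideanSpace.basisFun (Fin d) ℝ).sum_repr v

lemma integral_fderiv_eq_zero {φ : E → ℝ} (hφ : ContDiff ℝ ∞ φ) (hc : HasCompactSupport φ) (v : E) :
    ∫ x, fderiv ℝ φ x v = 0 := by
  have hcont : Continuous fun x => fderiv ℝ φ x v :=
    (hφ.continuous_fderiv (by simp)).clm_apply continuous_const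
  have hint : Integrable fun x => fderiv ℝ φ x v :=
    hcont.integrable_of_hasCompactSupport (hc.fderiv_apply ℝ v)
  have := integral_mul_fderiv_eq_neg_fderiv_mul_of_integrable (μ := (volume : Measure E))
    (f := fun _ => (1 : ℝ)) (g := φ) (v := v) (by simp) (by simpa using hint)
    (by simpa using hφ.continuous.integrable_of_hasCompactSupport hc) (by simp)
    (fun x _ => hφ.differentiable (by simp) x)
  simpa using this

/-- Piola's identity for a volume preserving diffeomorphism `e`: the pullback of a constant vector
field is divergence free. It is the weak form of the statement that `∫ ∂ᵥ(ζ ∘ e) = 0`. -/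
lemma VolumePreservingDiffeo.isDivFree_fderiv (e : VolumePreservingDiffeo d) (v : E) :
    IsDivFree fun y => fderiv ℝ e.toHomeo (e.toHomeo.symm y) v := by
  set a : E → E := fun y => fderiv ℝ e.toHomeo (e.toHomeo.symm y) v with ha_def
  have ha : ContDiff ℝ ∞ a :=
    ((e.contDiff.fderiv_right (m := ∞) (by simp)).comp e.contDiff_symm).clm_apply contDiff_const
  have hai : ∀ i, ContDiff ℝ ∞ fun y => a y i := fun i => by fun_prop
  have hda : ∀ y i, fderiv ℝ (fun y => a y i) y (EuclideanSpace.single i 1)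
      = fderiv ℝ a y (EuclideanSpace.single i 1) i := fun y i => by
    have h := (EuclideanSpace.proj (𝕜 := ℝ) i : E →L[ℝ] ℝ).hasFDerivAt.comp y
      (ha.differentiable (by simp) y).hasFDerivAt
    rw [show (fun y => a y i) = (EuclideanSpace.proj (𝕜 := ℝ) i : E →L[ℝ] ℝ) ∘ a from rfl, h.fderiv]
    rfl
  have hdiv_cont : Continuous fun y => ∑ i : Fin d, fderiv ℝ a y (EuclideanSpace.single i 1) i := by
    have := ha.continuous_fderiv (by simp)
    fun_prop
  have key : ∀ ζ : E → ℝ, ContDiff ℝ ∞ ζ → HasCompactSupport ζ →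
      ∫ y, ζ y • ∑ i : Fin d, fderiv ℝ a y (EuclideanSpace.single i 1) i = 0 := by
    intro ζ hζ hζc
    have h1 : ∫ y, fderiv ℝ ζ y (a y) = 0 := by
      rw [← e.integral_comp]
      rw [← integral_fderiv_eq_zero (hζ.comp e.contDiff)
        (hζc.comp_isClosedEmbedding e.toHomeo.isClosedEmbedding) v]
      congr 1; ext x
      rw [fderiv_comp x (hζ.differentiable (by simp) _) (e.differentiable x)]
      simp [a]
    have hI : ∀ i, ∫ y, a y i * fderiv ℝ ζ y (EuclideanSpace.single i 1) =
        - ∫ y, fderiv ℝ a y (EuclideanSpace.single i 1) i * ζ y := by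
      intro i
      simp_rw [← hda]
      have c1 : Continuous fun y => fderiv ℝ (fun y => a y i) y (EuclideanSpace.single i 1) :=
        ((hai i).continuous_fderiv (by simp)).clm_apply continuous_const
      have c2 : Continuous fun y => fderiv ℝ ζ y (EuclideanSpace.single i 1) :=
        (hζ.continuous_fderiv (by simp)).clm_apply continuous_const
      refine integral_mul_fderiv_eq_neg_fderiv_mul_of_integrable ?_ ?_ ?_
        (fun x _ => (hai i).differentiable (by simp) x) (fun x _ => hζ.differentiable (by simp) x)
      · exact (c1.mul hζ.continuous).integrable_of_hasCompactSupport hζc.mul_left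
      · exact ((hai i).continuous.mul c2).integrable_of_hasCompactSupport
          (hζc.fderiv_apply ℝ _).mul_left
      · exact ((hai i).continuous.mul hζ.continuous).integrable_of_hasCompactSupport hζc.mul_left
    have hsum : ∀ y, fderiv ℝ ζ y (a y)
        = ∑ i, a y i * fderiv ℝ ζ y (EuclideanSpace.single i 1) := fun y => by
      conv_lhs => rw [← EuclideanSpace.sum_apply_smul_single (a y)]
      simp
    simp_rw [hsum] at h1
    rw [integral_finsetSum _ fun i _ => ?_] at h1
    · simp_rw [hI] at h1
      rw [Finset.sum_neg_distrib, neg_eq_zero, ← integral_finsetSum _ fun i _ => ?_] at h1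
      · rw [← h1]; congr 1; ext y; rw [smul_eq_mul, Finset.mul_sum]
        exact Finset.sum_congr rfl fun i _ => mul_comm _ _
      · have c1 : Continuous fun y => fderiv ℝ a y (EuclideanSpace.single i 1) i := by
          have := ha.continuous_fderiv (by simp)
          fun_prop
        exact (c1.mul hζ.continuous).integrable_of_hasCompactSupport hζc.mul_left
    · have c2 : Continuous fun y => fderiv ℝ ζ y (EuclideanSpace.single i 1) :=
        (hζ.continuous_fderiv (by simp)).clm_apply continuous_const
      exact ((hai i).continuous.mul c2).integrable_of_hasCompactSupport
          (hζc.fderiv_apply ℝ _).mul_left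
  have hae := ae_eq_zero_of_integral_contDiff_smul_eq_zero
    (hdiv_cont.locallyIntegrable (μ := volume)) key
  have := (hdiv_cont.ae_eq_iff_eq volume continuous_const).1 hae
  exact fun y => congrFun this y

lemma MemL2loc.locallyIntegrable {F : Type*} [NormedAddCommGroup F] {f : E → F} (hf : MemL2loc f) :
    LocallyIntegrable f volume := by
  rw [locallyIntegrable_iff]
  intro K hK
  have : IsFiniteMeasure (volume.restrict K : Measure E) :=
    isFiniteMeasure_restrict.2 hK.measure_lt_top.ne
  exact (hf K hK).integrable (by norm_num)

lemma MemL2loc.aestronglyMeasurable {F : Type*} [NormedAddCommGroup F] {f : E → F}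
    (hf : MemL2loc f) : AEStronglyMeasurable f volume :=
  hf.locallyIntegrable.aestronglyMeasurable

lemma MemL2loc.comp {F : Type*} [NormedAddCommGroup F] {f : E → F} (hf : MemL2loc f)
    (e : VolumePreservingDiffeo d) : MemL2loc (fun x => f (e.toHomeo x)) := fun K hK =>
  (hf _ (hK.image e.toHomeo.continuous)).comp_measurePreserving (e.measurePreserving_restrict K)

lemma memL2loc_adjoint_comp {g : E → E} (hg : MemL2loc g) (e : VolumePreservingDiffeo d) :
    MemL2loc (fun x => ContinuousLinearMap.adjoint (fderiv ℝ e.toHomeo x) (g (e.toHomeo x))) := by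
  intro K hK
  have hgc := hg.comp e
  have hcont : Continuous fun x => ContinuousLinearMap.adjoint (fderiv ℝ e.toHomeo x) :=
    (LinearIsometryEquiv.continuous ContinuousLinearMap.adjoint).comp
      (e.contDiff.continuous_fderiv (by simp))
  obtain ⟨C, hC⟩ := hK.exists_bound_of_continuousOn hcont.continuousOn
  refine (hgc K hK).of_le_mul (c := C) ?_ ?_
  · exact Continuous.comp_aestronglyMeasurable₂ (g := fun (L : E →L[ℝ] E) v => L v)
      isBoundedBilinearMap_apply.continuous hcont.aestronglyMeasurable (hgc K hK).1
  · filter_upwards [ae_restrict_mem hK.measurableSet] with x hx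
    exact (ContinuousLinearMap.le_opNorm _ _).trans
      (mul_le_mul_of_nonneg_right (hC x hx) (norm_nonneg _))

/-- The chain rule for weak gradients. The test functions used for `f` are
`(φ ∘ e⁻¹) aₖ`, with `a` the pullback of a coordinate field, so that Piola's identity applies. -/
lemma HasWeakGradient.comp {f : E → ℝ} {g : E → E} (h : HasWeakGradient f g) (hf : MemL2loc f)
    (hg : MemL2loc g) (e : VolumePreservingDiffeo d) :
    HasWeakGradient (fun x => f (e.toHomeo x))
      (fun x => ContinuousLinearMap.adjoint (fderiv ℝ e.toHomeo x) (g (e.toHomeo x))) := by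
  intro φ hφ hφc i
  set a : E → E := fun y => fderiv ℝ e.toHomeo (e.toHomeo.symm y) (EuclideanSpace.single i 1)
    with ha_def
  have ha : ContDiff ℝ ∞ a :=
    ((e.contDiff.fderiv_right (m := ∞) (by simp)).comp e.contDiff_symm).clm_apply contDiff_const
  have hak : ∀ k, ContDiff ℝ ∞ fun y => a y k := fun k => by fun_prop
  set Φ : E → ℝ := φ ∘ e.toHomeo.symm with hΦ_def
  have hΦ : ContDiff ℝ ∞ Φ := hφ.comp e.contDiff_symm
  have hΦc : HasCompactSupport Φ := hφc.comp_isClosedEmbedding e.toHomeo.symm.isClosedEmbedding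
  have hPk : ∀ k, ContDiff ℝ ∞ fun y => Φ y * a y k := fun k => hΦ.mul (hak k)
  have hPkc : ∀ k, HasCompactSupport fun y => Φ y * a y k := fun k => hΦc.mul_right
  have hk := fun k => h (fun y => Φ y * a y k) (hPk k) (hPkc k) k
  have hdiv := e.isDivFree_fderiv (EuclideanSpace.single i 1)
  have hda : ∀ y k, fderiv ℝ (fun y => a y k) y (EuclideanSpace.single k 1)
      = fderiv ℝ a y (EuclideanSpace.single k 1) k := fun y k => by
    have h := (EuclideanSpace.proj (𝕜 := ℝ) k : E →L[ℝ] ℝ).hasFDerivAt.comp y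
      (ha.differentiable (by simp) y).hasFDerivAt
    rw [show (fun y => a y k) = (EuclideanSpace.proj (𝕜 := ℝ) k : E →L[ℝ] ℝ) ∘ a from rfl, h.fderiv]
    rfl
  have hsum : ∀ y, ∑ k, fderiv ℝ (fun y => Φ y * a y k) y (EuclideanSpace.single k 1)
      = fderiv ℝ φ (e.toHomeo.symm y) (EuclideanSpace.single i 1) := fun y => by
    have h1 : ∀ k, fderiv ℝ (fun y => Φ y * a y k) y (EuclideanSpace.single k 1)
        = fderiv ℝ Φ y (a y k • EuclideanSpace.single k 1)
          + Φ y * fderiv ℝ a y (EuclideanSpace.single k 1) k := fun k => by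
      rw [fderiv_fun_mul (hΦ.differentiable (by simp) y) ((hak k).differentiable (by simp) y),
        ← hda]
      simp; ring
    simp_rw [h1]
    rw [Finset.sum_add_distrib, ← map_sum, EuclideanSpace.sum_apply_smul_single,
      ← Finset.mul_sum, hdiv y, mul_zero, add_zero, hΦ_def,
      fderiv_comp y (hφ.differentiable (by simp) _) (e.contDiff_symm.differentiable (by simp) y)]
    have h2 := e.fderiv_symm_comp (e.toHomeo.symm y) (EuclideanSpace.single i 1)
    rw [e.toHomeo.apply_symm_apply] at h2
    simp [a, h2]
  have I1 : ∀ k, Integrable fun y =>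
      f y * fderiv ℝ (fun y => Φ y * a y k) y (EuclideanSpace.single k 1) := fun k => by
    have := hf.locallyIntegrable.integrable_smul_right_of_hasCompactSupport
      (g := fun y => fderiv ℝ (fun y => Φ y * a y k) y (EuclideanSpace.single k 1))
      (((hPk k).continuous_fderiv (by simp)).clm_apply continuous_const)
      ((hPkc k).fderiv_apply ℝ _)
    simpa using this
  have hgk : ∀ k, LocallyIntegrable (fun y => g y k) volume := fun k => by
    rw [locallyIntegrable_iff]
    intro K hK
    exact (EuclideanSpace.proj (𝕜 := ℝ) k : E →L[ℝ] ℝ).integrable_comp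
      (locallyIntegrable_iff.1 hg.locallyIntegrable K hK)
  have I2 : ∀ k, Integrable fun y => Φ y * a y k * g y k := fun k => by
    have := (hgk k).integrable_smul_left_of_hasCompactSupport (hPk k).continuous (hPkc k)
    simpa using this
  have hfin : ∫ y, f y * fderiv ℝ φ (e.toHomeo.symm y) (EuclideanSpace.single i 1)
      = - ∫ y, Φ y * inner ℝ (a y) (g y) := by
    calc _ = ∫ y, ∑ k, f y * fderiv ℝ (fun y => Φ y * a y k) y (EuclideanSpace.single k 1) := by
          congr 1; ext y; rw [← hsum, Finset.mul_sum]
      _ = - ∫ y, ∑ k, Φ y * a y k * g y k := by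
          rw [integral_finsetSum _ fun k _ => I1 k, integral_finsetSum _ fun k _ => I2 k,
            ← Finset.sum_neg_distrib]
          exact Finset.sum_congr rfl fun k _ => hk k
      _ = _ := by
          congr 2; ext y
          rw [PiLp.inner_apply, Finset.mul_sum]
          refine Finset.sum_congr rfl fun k _ => ?_
          simp; ring
  rw [← e.integral_comp, ← e.integral_comp (fun y => Φ y * inner ℝ (a y) (g y))] at hfin
  simp only [hΦ_def, ha_def, Function.comp_apply, Homeomorph.symm_apply_apply] at hfin
  rw [hfin]
  congr 2; ext x
  rw [← ContinuousLinearMap.adjoint_inner_right, EuclideanSpace.inner_single_left]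
  simp

lemma MemH1loc.weakGrad_memL2loc {f : E → ℝ} (h : MemH1loc f) : MemL2loc (weakGrad f) := by
  rw [weakGrad, dif_pos h]; exact h.2.choose_spec.1

lemma MemH1loc.hasWeakGradient {f : E → ℝ} (h : MemH1loc f) : HasWeakGradient f (weakGrad f) := by
  rw [weakGrad, dif_pos h]; exact h.2.choose_spec.2

/-- Weak gradients are unique almost everywhere. -/
lemma HasWeakGradient.ae_eq {f : E → ℝ} {g g' : E → E} (h : HasWeakGradient f g)
    (h' : HasWeakGradient f g') (hg : MemL2loc g) (hg' : MemL2loc g') : g =ᵐ[volume] g' := by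
  have hk : ∀ {g : E → E} (_ : MemL2loc g) (k), LocallyIntegrable (fun y => g y k) volume := by
    intro g hg k
    rw [locallyIntegrable_iff]
    intro K hK
    exact (EuclideanSpace.proj (𝕜 := ℝ) k : E →L[ℝ] ℝ).integrable_comp
      (locallyIntegrable_iff.1 hg.locallyIntegrable K hK)
  have : ∀ k, ∀ᵐ y, g y k = g' y k := fun k => by
    refine ae_eq_of_integral_contDiff_smul_eq (hk hg k) (hk hg' k) fun φ hφ hφc => ?_
    have h1 := h φ hφ hφc k
    rw [h' φ hφ hφc k, neg_inj] at h1
    simpa using h1.symm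
  filter_upwards [ae_all_iff.2 this] with y hy
  ext k; exact hy k

lemma MemH1loc.comp {f : E → ℝ} (h : MemH1loc f) (e : VolumePreservingDiffeo d) :
    MemH1loc (fun x => f (e.toHomeo x)) :=
  ⟨h.1.comp e, _, memL2loc_adjoint_comp h.weakGrad_memL2loc e,
    h.hasWeakGradient.comp h.1 h.weakGrad_memL2loc e⟩

lemma weakGrad_comp {f : E → ℝ} (h : MemH1loc f) (e : VolumePreservingDiffeo d) :
    weakGrad (fun x => f (e.toHomeo x)) =ᵐ[volume] fun x =>
      ContinuousLinearMap.adjoint (fderiv ℝ e.toHomeo x) (weakGrad f (e.toHomeo x)) :=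
  (h.comp e).hasWeakGradient.ae_eq (h.hasWeakGradient.comp h.1 h.weakGrad_memL2loc e)
    (h.comp e).weakGrad_memL2loc (memL2loc_adjoint_comp h.weakGrad_memL2loc e)

lemma gradL2Norm_sq (f : E → ℝ) (Ω : Set E) :
    gradL2Norm f Ω ^ 2 = ∫⁻ x in Ω, ‖weakGrad f x‖ₑ ^ 2 := by
  rw [gradL2Norm, eLpNorm_eq_lintegral_rpow_enorm_toReal (by norm_num) (by norm_num)]
  rw [← ENNReal.rpow_natCast, ← ENNReal.rpow_mul]
  simp

/-- The gradient norm of a composition, written in the coordinates before the composition. -/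
lemma gradL2Norm_comp_sq {f : E → ℝ} (h : MemH1loc f) (e : VolumePreservingDiffeo d) (Ω : Set E) :
    gradL2Norm (fun x => f (e.toHomeo x)) Ω ^ 2 = ∫⁻ y in e.toHomeo '' Ω,
      ‖ContinuousLinearMap.adjoint (fderiv ℝ e.toHomeo (e.toHomeo.symm y)) (weakGrad f y)‖ₑ ^ 2 := by
  have hae : ∀ᵐ x ∂(volume.restrict Ω), ‖weakGrad (fun x => f (e.toHomeo x)) x‖ₑ ^ 2 =
      ‖ContinuousLinearMap.adjoint (fderiv ℝ e.toHomeo x) (weakGrad f (e.toHomeo x))‖ₑ ^ 2 := by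
    filter_upwards [ae_restrict_of_ae (weakGrad_comp h e)] with x hx
    rw [hx]
  rw [gradL2Norm_sq, lintegral_congr_ae hae, ← (e.measurePreserving_restrict Ω).lintegral_comp_emb e.toHomeo.measurableEmbedding]
  simp

end WeakGradient

/-! ### The transport equation on a time slab -/

section Transport

variable {d : ℕ}

local notation "E" => EuclideanSpace ℝ (Fin d)

/-- The function `χ(t, y) = -∫ₜᵗ⁺ᴸ g(s, y) ds` is smooth and compactly supported, with
`∂ₜχ(t, y) = g(t, y) - g(t + L, y)`. The integral over a finite window, instead of the half line
`[t, ∞)`, makes the support compact. -/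
lemma exists_contDiff_window_primitive {g : ℝ × E → ℝ} (hg : ContDiff ℝ ∞ g)
    (hgc : HasCompactSupport g) {L : ℝ} (hL : 0 ≤ L) :
    ∃ χ : ℝ × E → ℝ, ContDiff ℝ ∞ χ ∧ HasCompactSupport χ ∧
      (∀ b, tsupport g ⊆ {p | p.1 < b} → tsupport χ ⊆ {p | p.1 < b}) ∧
      ∀ p, fderiv ℝ χ p (1, 0) = g p - g (p.1 + L, p.2) := by
  set χ : ℝ × E → ℝ := fun p => -∫ s in (0 : ℝ)..L, g (p.1 + s, p.2) with hχ_def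
  have hχ : ContDiff ℝ ∞ χ := by
    -- `χ` is the convolution of `g` with the measure `ds` on the segment `[-L, 0] × {0}`
    set ι : ℝ → ℝ × E := fun s => (-s, 0)
    have hι : Continuous ι := by fun_prop
    set μ : Measure (ℝ × E) := (volume.restrict (Ioc 0 L)).map ι with hμ
    have : IsFiniteMeasure μ := Measure.isFiniteMeasure_map _ _
    have h := hgc.contDiff_convolution_right (n := ⊤) (ContinuousLinearMap.lsmul ℝ ℝ)
      (locallyIntegrable_const (μ := μ) (1 : ℝ)) hg
    have heq : χ = fun p => -(convolution (fun _ => (1 : ℝ)) g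
        (ContinuousLinearMap.lsmul ℝ ℝ) μ) p := by
      ext p
      rw [convolution_def, hμ, integral_map hι.aemeasurable, hχ_def]
      · simp only [intervalIntegral.integral_of_le hL]
        simp [ι, Prod.sub_def]
      · have := hg.continuous
        exact Continuous.aestronglyMeasurable (by simp; fun_prop)
    rw [heq]
    exact h.neg
  have hcpt : IsCompact ((fun q : ℝ × (ℝ × E) => (q.2.1 - q.1, q.2.2)) ''
      (Icc 0 L ×ˢ tsupport g)) :=
    (isCompact_Icc.prod hgc).image (by fun_prop)
  have hsupp : tsupport χ ⊆ (fun q : ℝ × (ℝ × E) => (q.2.1 - q.1, q.2.2)) ''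
      (Icc 0 L ×ˢ tsupport g) := by
    refine closure_minimal (fun p hp => ?_) hcpt.isClosed
    by_contra hcon
    apply hp
    have h0 : ∀ s ∈ uIcc 0 L, g (p.1 + s, p.2) = 0 := fun s hs => by
      rw [uIcc_of_le hL] at hs
      by_contra hne
      exact hcon ⟨(s, (p.1 + s, p.2)), ⟨hs, subset_tsupport _ hne⟩, by simp⟩
    rw [hχ_def]
    simp only [intervalIntegral.integral_congr h0]
    simp
  refine ⟨χ, hχ, HasCompactSupport.of_support_subset_isCompact hcpt
    ((subset_tsupport _).trans hsupp), ?_, ?_⟩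
  · intro b hb p hp
    obtain ⟨⟨s, q⟩, ⟨hs, hq⟩, rfl⟩ := hsupp hp
    have := hb hq
    simp only [mem_ofPred_eq] at this ⊢
    linarith [hs.1]
  · intro p
    have h1 : HasDerivAt (fun t : ℝ => χ (p + t • ((1 : ℝ), (0 : E))))
        (fderiv ℝ χ p (1, 0)) 0 :=
      HasFDerivAt.hasLineDerivAt (hχ.differentiable (by simp) p).hasFDerivAt _
    have hgl : Continuous fun σ : ℝ => g (σ, p.2) := hg.continuous.comp (by fun_prop)
    have h2 : HasDerivAt (fun t : ℝ => χ (p + t • ((1 : ℝ), (0 : E))))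
        (-(g (p.1 + L, p.2) - g (p.1, p.2))) 0 := by
      have heq : (fun t : ℝ => χ (p + t • ((1 : ℝ), (0 : E)))) = fun t =>
          -((∫ σ in (0:ℝ)..(p.1 + t + L), g (σ, p.2)) - ∫ σ in (0:ℝ)..(p.1 + t), g (σ, p.2)) := by
        ext t
        rw [intervalIntegral.integral_interval_sub_left (hgl.intervalIntegrable _ _)
          (hgl.intervalIntegrable _ _)]
        have := intervalIntegral.integral_comp_add_left (a := 0) (b := L)
          (fun σ => g (σ, p.2)) (p.1 + t)
        rw [add_zero] at this
        simp [hχ_def, ← this]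
      rw [heq]
      have e1 : HasDerivAt (fun t : ℝ => p.1 + t + L) 1 0 :=
        ((hasDerivAt_id (0 : ℝ)).const_add p.1).add_const L
      have e2 : HasDerivAt (fun t : ℝ => p.1 + t) 1 0 := (hasDerivAt_id (0 : ℝ)).const_add p.1
      have d1 := (hgl.integral_hasStrictDerivAt 0 (p.1 + 0 + L)).hasDerivAt.comp (0 : ℝ) e1
      have d2 := (hgl.integral_hasStrictDerivAt 0 (p.1 + 0)).hasDerivAt.comp (0 : ℝ) e2
      refine ((d1.sub d2).neg).congr_deriv ?_
      simp
    rw [h1.unique h2]; ring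

/-- A function on `[0, ∞) × ℝ^d` in the class `L^∞([0, ∞); L²_loc)` is locally integrable. -/
lemma locallyIntegrable_of_eLpNorm_bounded {θ : ℝ → E → ℝ}
    (hm : AEStronglyMeasurable (fun p : ℝ × E => θ p.1 p.2)
      (volume.restrict (Ici (0 : ℝ) ×ˢ univ)))
    (hb : ∀ K : Set E, IsCompact K → ∃ M : ℝ≥0, ∀ᵐ t ∂(volume.restrict (Ici (0 : ℝ))),
      eLpNorm (θ t) 2 (volume.restrict K) ≤ M) :
    LocallyIntegrable (fun p : ℝ × E => θ p.1 p.2) (volume.restrict (Ici (0 : ℝ) ×ˢ univ)) := by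
  rw [locallyIntegrable_iff]
  intro K hK
  have hK1 := hK.image continuous_fst
  have hK2 := hK.image continuous_snd
  set K1 := Prod.fst '' K
  set K2 := Prod.snd '' K
  have hsub : K ⊆ K1 ×ˢ K2 := fun p hp => ⟨⟨p, hp, rfl⟩, ⟨p, hp, rfl⟩⟩
  refine IntegrableOn.mono_set ?_ hsub
  have hrestr : ((volume : Measure (ℝ × E)).restrict (Ici (0 : ℝ) ×ˢ univ)).restrict (K1 ×ˢ K2)
      = (volume.restrict (K1 ∩ Ici 0)).prod (volume.restrict K2) := by
    rw [Measure.restrict_restrict (hK1.measurableSet.prod hK2.measurableSet), prod_inter_prod,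
      inter_univ, Measure.prod_restrict]
    rfl
  refine ⟨hm.mono_measure Measure.restrict_le_self, ?_⟩
  have hm' := hm.mono_measure (Measure.restrict_le_self (s := K1 ×ˢ K2))
  rw [hrestr] at hm' ⊢
  obtain ⟨M, hM⟩ := hb K2 hK2
  have hfin : IsFiniteMeasure (volume.restrict K2 : Measure E) :=
    isFiniteMeasure_restrict.2 hK2.measure_lt_top.ne
  have hfin1 : IsFiniteMeasure (volume.restrict (K1 ∩ Ici 0) : Measure ℝ) :=
    isFiniteMeasure_restrict.2 ((measure_mono inter_subset_left).trans_lt hK1.measure_lt_top).ne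
  rw [HasFiniteIntegral, lintegral_prod _ hm'.enorm]
  set c : ℝ≥0∞ := (volume.restrict K2 : Measure E) univ ^ (1 / (1 : ℝ≥0∞).toReal - 1 / (2 : ℝ≥0∞).toReal)
  have hc : c ≠ ⊤ := ENNReal.rpow_ne_top_of_nonneg (by norm_num) (measure_ne_top _ _)
  have hae : ∀ᵐ t ∂(volume.restrict (K1 ∩ Ici (0 : ℝ))), ∫⁻ y in K2, ‖θ t y‖ₑ ≤ M * c := by
    filter_upwards [ae_restrict_of_ae_restrict_of_subset inter_subset_right hM, hm'.prodMk_left]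
      with t ht hmt
    have := eLpNorm_le_eLpNorm_mul_rpow_measure_univ (p := 1) (q := 2) (by norm_num) hmt
    rw [eLpNorm_one_eq_lintegral_enorm] at this
    exact this.trans (mul_le_mul_left ht _)
  calc _ ≤ ∫⁻ _ in K1 ∩ Ici (0 : ℝ), (M * c : ℝ≥0∞) := lintegral_mono_ae hae
    _ < ⊤ := by
      rw [lintegral_const]
      exact ENNReal.mul_lt_top (ENNReal.mul_lt_top ENNReal.coe_lt_top hc.lt_top)
        (measure_lt_top _ _)

lemma locallyIntegrable_comp_snd {f : E → ℝ} (hf : LocallyIntegrable f volume) :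
    LocallyIntegrable (fun p : ℝ × E => f p.2) volume := by
  rw [locallyIntegrable_iff]
  intro K hK
  have hK1 := hK.image continuous_fst
  have hK2 := hK.image continuous_snd
  have hsub : K ⊆ (Prod.fst '' K) ×ˢ (Prod.snd '' K) :=
    fun p hp => ⟨⟨p, hp, rfl⟩, ⟨p, hp, rfl⟩⟩
  refine IntegrableOn.mono_set ?_ hsub
  have hfin1 : IsFiniteMeasure (volume.restrict (Prod.fst '' K) : Measure ℝ) :=
    isFiniteMeasure_restrict.2 hK1.measure_lt_top.ne
  rw [IntegrableOn, Measure.volume_eq_prod, ← Measure.prod_restrict]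
  exact Integrable.comp_snd (locallyIntegrable_iff.1 hf _ hK2) _

namespace VolumePreservingFlow

variable (V : VolumePreservingFlow d)

lemma flow_neg_flow (t : ℝ) (x : E) : V.flow (-t) (V.flow t x) = x := by
  rw [← V.flow_add, neg_add_cancel, V.flow_zero]

lemma flow_flow_neg (t : ℝ) (x : E) : V.flow t (V.flow (-t) x) = x := by
  simpa using V.flow_neg_flow (-t) x

lemma contDiff_flow_comp {G : Type*} [NormedAddCommGroup G] [NormedSpace ℝ G] {a : G → ℝ}
    {z : G → E} (ha : ContDiff ℝ ∞ a) (hz : ContDiff ℝ ∞ z) :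
    ContDiff ℝ ∞ fun p => V.flow (a p) (z p) :=
  V.contDiff_flow.comp (ha.prodMk hz)

lemma continuous_flow_comp {G : Type*} [TopologicalSpace G] {a : G → ℝ}
    {z : G → E} (ha : Continuous a) (hz : Continuous z) :
    Continuous fun p => V.flow (a p) (z p) :=
  V.contDiff_flow.continuous.comp (ha.prodMk hz)

/-- The time-`t` map of the flow. -/
def diffeo (t : ℝ) : VolumePreservingDiffeo d where
  toHomeo :=
    { toFun := V.flow t
      invFun := V.flow (-t)
      left_inv := V.flow_neg_flow t
      right_inv := V.flow_flow_neg t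
      continuous_toFun := V.continuous_flow_comp continuous_const continuous_id
      continuous_invFun := V.continuous_flow_comp continuous_const continuous_id }
  contDiff := V.contDiff_flow_comp contDiff_const contDiff_id
  contDiff_symm := V.contDiff_flow_comp contDiff_const contDiff_id
  measurePreserving := V.measurePreserving_flow t

lemma diffeo_apply (t : ℝ) (x : E) : (V.diffeo t).toHomeo x = V.flow t x := rfl

/-- The space-time map `(t, y) ↦ (t, X(t - a, y))` from Lagrangian to Eulerian coordinates, where
`X` is the flow. -/
def spacetime (a : ℝ) : (ℝ × EuclideanSpace ℝ (Fin d)) ≃ₜ (ℝ × EuclideanSpace ℝ (Fin d)) where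
  toFun p := (p.1, V.flow (p.1 - a) p.2)
  invFun p := (p.1, V.flow (-(p.1 - a)) p.2)
  left_inv p := by simp only [flow_neg_flow]
  right_inv p := by simp only [flow_flow_neg]
  continuous_toFun := continuous_fst.prodMk (V.continuous_flow_comp (by fun_prop) (by fun_prop))
  continuous_invFun := continuous_fst.prodMk (V.continuous_flow_comp (by fun_prop) (by fun_prop))

lemma spacetime_apply (a : ℝ) (p : ℝ × E) :
    V.spacetime a p = (p.1, V.flow (p.1 - a) p.2) := rfl

lemma contDiff_spacetime (a : ℝ) : ContDiff ℝ ∞ (V.spacetime a) :=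
  contDiff_fst.prodMk (V.contDiff_flow_comp (by fun_prop) (by fun_prop))

lemma contDiff_spacetime_symm (a : ℝ) : ContDiff ℝ ∞ (V.spacetime a).symm :=
  contDiff_fst.prodMk (V.contDiff_flow_comp (by fun_prop) (by fun_prop))

lemma measurePreserving_spacetime (a : ℝ) :
    MeasurePreserving (V.spacetime a) volume volume :=
  (MeasurePreserving.id (volume : Measure ℝ)).skew_product
    (g := fun t y => V.flow (t - a) y)
    (V.continuous_flow_comp (by fun_prop) (by fun_prop)).measurable
    (Eventually.of_forall fun t => (V.measurePreserving_flow (t - a)).map_eq)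

lemma measurePreserving_spacetime_restrict (a : ℝ) (I : Set ℝ) :
    MeasurePreserving (V.spacetime a) (volume.restrict (I ×ˢ univ))
      (volume.restrict (I ×ˢ univ)) := by
  have := (V.measurePreserving_spacetime a).restrict_preimage_emb
    (V.spacetime a).measurableEmbedding (I ×ˢ univ)
  rwa [show V.spacetime a ⁻¹' (I ×ˢ univ) = I ×ˢ univ by ext p; simp [spacetime_apply]] at this

/-- The material derivative becomes the time derivative in Lagrangian coordinates. -/
lemma fderiv_comp_spacetime {ψ : ℝ × E → ℝ} (hψ : ContDiff ℝ ∞ ψ) (a : ℝ) (p : ℝ × E) :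
    fderiv ℝ (ψ ∘ V.spacetime a) p (1, 0) =
      fderiv ℝ ψ (V.spacetime a p) (1, V.field (V.spacetime a p).2) := by
  have h1 : HasDerivAt (fun t : ℝ => (ψ ∘ V.spacetime a) (p + t • ((1 : ℝ), (0 : E))))
      (fderiv ℝ (ψ ∘ V.spacetime a) p (1, 0)) 0 :=
    HasFDerivAt.hasLineDerivAt
      ((hψ.comp (V.contDiff_spacetime a)).differentiable (by simp) p).hasFDerivAt _
  have h2 : HasDerivAt (fun t : ℝ => V.spacetime a (p + t • ((1 : ℝ), (0 : E))))
      (1, V.field (V.spacetime a p).2) 0 := by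
    have e1 : HasDerivAt (fun t : ℝ => p.1 + t) 1 0 := (hasDerivAt_id (0 : ℝ)).const_add p.1
    have e2 : HasDerivAt (fun t : ℝ => p.1 - a + t) 1 0 := (hasDerivAt_id (0 : ℝ)).const_add _
    have e3 := (V.hasDerivAt_flow (p.1 - a + 0) p.2).scomp (0 : ℝ) e2
    have := e1.prodMk e3
    simp only [spacetime_apply]
    simpa [Function.comp_def, add_sub_right_comm] using this
  have h3 : HasFDerivAt ψ (fderiv ℝ ψ (V.spacetime a p))
      (V.spacetime a (p + (0 : ℝ) • ((1 : ℝ), (0 : E)))) := by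
    simpa using (hψ.differentiable (by simp) (V.spacetime a p)).hasFDerivAt
  exact h1.unique (h3.comp_hasDerivAt 0 h2)

lemma integrableOn_slab {w : ℝ × E → ℝ} {I : Set ℝ} (hI : I ⊆ Ici 0)
    (hw : LocallyIntegrable w (volume.restrict (Ici (0 : ℝ) ×ˢ univ)))
    {ψ : ℝ × E → ℝ} (hψ : ContDiff ℝ ∞ ψ) (hψc : HasCompactSupport ψ) :
    IntegrableOn (fun p => w p * fderiv ℝ ψ p (1, V.field p.2)) (I ×ˢ univ) := by
  have hw' : LocallyIntegrable w (volume.restrict (I ×ˢ univ)) :=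
    hw.mono_measure (Measure.restrict_mono (prod_mono hI le_rfl) le_rfl)
  have hc : Continuous fun p : ℝ × E => fderiv ℝ ψ p (1, V.field p.2) :=
    (hψ.continuous_fderiv (by simp)).clm_apply
      (continuous_const.prodMk (V.contDiff_field.continuous.comp continuous_snd))
  have hs : HasCompactSupport fun p : ℝ × E => fderiv ℝ ψ p (1, V.field p.2) := by
    refine (hψc.fderiv ℝ).mono fun p hp => ?_
    rw [Function.mem_support] at hp ⊢
    intro h0; rw [h0] at hp; exact hp rfl
  have := hw'.integrable_smul_right_of_hasCompactSupport hc hs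
  simpa [IntegrableOn] using this

/-- The weak transport equation on the slab `[a, b) × ℝ^d`, for data carried by the flow. -/
lemma integral_slab {f : E → ℝ} (hf : LocallyIntegrable f volume) {a b : ℝ} (hab : a ≤ b)
    {ψ : ℝ × E → ℝ} (hψ : ContDiff ℝ ∞ ψ) (hψc : HasCompactSupport ψ) :
    ∫ p in Ico a b ×ˢ univ, f (V.flow (-(p.1 - a)) p.2) * fderiv ℝ ψ p (1, V.field p.2) =
      (∫ x, f (V.flow (-(b - a)) x) * ψ (b, x)) - ∫ x, f x * ψ (a, x) := by
  set χ := ψ ∘ V.spacetime a with hχ_def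
  have hχ : ContDiff ℝ ∞ χ := hψ.comp (V.contDiff_spacetime a)
  have hχc : HasCompactSupport χ := hψc.comp_isClosedEmbedding (V.spacetime a).isClosedEmbedding
  have hdχ : Continuous fun p => fderiv ℝ χ p ((1 : ℝ), (0 : E)) :=
    (hχ.continuous_fderiv (by simp)).clm_apply continuous_const
  rw [← (V.measurePreserving_spacetime_restrict a (Ico a b)).integral_comp
    (V.spacetime a).measurableEmbedding]
  have h1 : ∀ p : ℝ × E, f (V.flow (-((V.spacetime a p).1 - a)) (V.spacetime a p).2) *
      fderiv ℝ ψ (V.spacetime a p) (1, V.field (V.spacetime a p).2) =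
      f p.2 * fderiv ℝ χ p (1, 0) := fun p => by
    rw [hχ_def, V.fderiv_comp_spacetime hψ]
    simp only [spacetime_apply, flow_neg_flow]
  simp_rw [h1]
  have hint : Integrable (fun p : ℝ × E => f p.2 * fderiv ℝ χ p (1, 0))
      ((volume.restrict (Ico a b)).prod volume) := by
    have := (locallyIntegrable_comp_snd hf).integrable_smul_right_of_hasCompactSupport hdχ
      (hχc.fderiv_apply ℝ _)
    have h2 : Integrable (fun p : ℝ × E => f p.2 * fderiv ℝ χ p (1, 0)) volume := by
      simpa using this
    have h3 := h2.integrableOn (s := Ico a b ×ˢ univ)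
    rwa [IntegrableOn, Measure.volume_eq_prod, ← Measure.prod_restrict, Measure.restrict_univ] at h3
  rw [Measure.volume_eq_prod, ← Measure.prod_restrict, Measure.restrict_univ,
    integral_prod_symm _ hint]
  have hinner : ∀ y, ∫ t in Ico a b, f y * fderiv ℝ χ (t, y) (1, 0)
      = f y * χ (b, y) - f y * χ (a, y) := fun y => by
    rw [integral_const_mul, ← mul_sub, integral_Ico_eq_integral_Ioc,
      ← intervalIntegral.integral_of_le hab]
    congr 1
    refine intervalIntegral.integral_eq_sub_of_hasDerivAt (f := fun t => χ (t, y)) (fun t _ => ?_)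
      (Continuous.intervalIntegrable (hdχ.comp (by fun_prop : Continuous fun t : ℝ => (t, y))) _ _)
    have e1 : HasDerivAt (fun t : ℝ => (t, y)) ((1 : ℝ), (0 : E)) t :=
      (hasDerivAt_id t).prodMk (hasDerivAt_const t y)
    have e2 : HasFDerivAt χ (fderiv ℝ χ (t, y)) (t, y) :=
      (hχ.differentiable (by simp) (t, y)).hasFDerivAt
    exact HasFDerivAt.comp_hasDerivAt (f := fun t => (t, y)) t e2 e1
  simp_rw [hinner]
  have hslice : ∀ c : ℝ, Integrable fun y => f y * χ (c, y) := fun c => by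
    have hcont : Continuous fun y : E => χ (c, y) := hχ.continuous.comp (by fun_prop)
    have hcpt : HasCompactSupport fun y : E => χ (c, y) :=
      hχc.comp_isClosedEmbedding (g := fun y : E => (c, y))
        (Isometry.isClosedEmbedding fun y z => by simp [Prod.edist_eq])
    simpa using hf.integrable_smul_right_of_hasCompactSupport hcont hcpt
  rw [integral_sub (hslice b) (hslice a)]
  congr 1
  · rw [← (V.diffeo (b - a)).integral_comp fun x => f (V.flow (-(b - a)) x) * ψ (b, x)]
    simp only [diffeo_apply, flow_neg_flow]
    rfl
  · simp [hχ_def, spacetime_apply, V.flow_zero]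

/-- Uniqueness on one slab: the weak transport equation on `[a, b) × ℝ^d`, tested with
functions that vanish for `t ≥ b`, forces a function with zero initial data to vanish. -/
lemma ae_eq_zero_on_slab {w : ℝ × E → ℝ} {a b : ℝ} (ha : 0 ≤ a) (hab : a ≤ b)
    (hw : LocallyIntegrable w (volume.restrict (Ici (0 : ℝ) ×ˢ univ)))
    (h : ∀ ψ : ℝ × E → ℝ, ContDiff ℝ ∞ ψ → HasCompactSupport ψ → tsupport ψ ⊆ {p | p.1 < b} →
      ∫ p in Ico a b ×ˢ univ, w p * fderiv ℝ ψ p (1, V.field p.2) = 0) :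
    ∀ᵐ p ∂(volume.restrict (Ico a b ×ˢ univ)), w p = 0 := by
  set μ : Measure (ℝ × E) := volume.restrict (Ico a b ×ˢ univ) with hμ
  have hmp : MeasurePreserving (V.spacetime a) μ μ := V.measurePreserving_spacetime_restrict a _
  have hwμ : LocallyIntegrable w μ :=
    hw.mono_measure (Measure.restrict_mono
      (prod_mono (fun t ht => ha.trans ht.1) le_rfl) le_rfl)
  have hwS : LocallyIntegrable (w ∘ V.spacetime a) μ := by
    rw [← locallyIntegrable_map_homeomorph, hmp.map_eq]; exact hwμ
  have hUsub : Ioo a b ×ˢ (univ : Set E) ⊆ Ico a b ×ˢ univ := prod_mono Ioo_subset_Ico_self le_rfl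
  have hU : ∀ᵐ p ∂(volume : Measure (ℝ × E)), p ∈ Ioo a b ×ˢ (univ : Set E) →
      (w ∘ V.spacetime a) p = 0 := by
    refine (isOpen_Ioo.prod isOpen_univ).ae_eq_zero_of_integral_contDiff_smul_eq_zero
      ((locallyIntegrableOn_of_locallyIntegrable_restrict hwS).mono_set hUsub) ?_
    intro g hg hgc hgU
    obtain ⟨χ, hχ, hχc, hχb, hdχ⟩ := exists_contDiff_window_primitive hg hgc (ha.trans hab)
    have hgb : tsupport g ⊆ {p | p.1 < b} := fun p hp => (hgU hp).1.2
    have hψc : HasCompactSupport (χ ∘ (V.spacetime a).symm) :=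
      hχc.comp_isClosedEmbedding (V.spacetime a).symm.isClosedEmbedding
    have hψ : ContDiff ℝ ∞ (χ ∘ (V.spacetime a).symm) := hχ.comp (V.contDiff_spacetime_symm a)
    have hψb : tsupport (χ ∘ (V.spacetime a).symm) ⊆ {p | p.1 < b} := by
      rw [tsupport_comp_eq_preimage]
      intro p hp
      have h2 : (V.spacetime a).symm p ∈ {p : ℝ × E | p.1 < b} := hχb b hgb hp
      exact h2
    have h0 := h _ hψ hψc hψb
    rw [← hmp.integral_comp (V.spacetime a).measurableEmbedding] at h0
    have h1 : ∀ p : ℝ × E, w (V.spacetime a p) *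
        fderiv ℝ (χ ∘ (V.spacetime a).symm) (V.spacetime a p) (1, V.field (V.spacetime a p).2)
        = w (V.spacetime a p) * (g p - g (p.1 + b, p.2)) := fun p => by
      rw [← V.fderiv_comp_spacetime hψ, ← hdχ]
      congr 3
      ext q : 1
      simp
    simp_rw [h1] at h0
    rw [← h0, ← setIntegral_eq_integral_of_forall_compl_eq_zero (s := Ico a b ×ˢ univ)]
    · refine setIntegral_congr_fun (measurableSet_Ico.prod MeasurableSet.univ) fun p hp => ?_
      -- the far end of the window of length `b` lies beyond the support of `g`
      have hz : g (p.1 + b, p.2) = 0 := by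
        refine image_eq_zero_of_notMem_tsupport fun hmem => ?_
        have h2 := hgb hmem
        have h3 := hp.1.1
        simp only [mem_ofPred_eq] at h2
        linarith
      simp only [hz, sub_zero, smul_eq_mul, Function.comp_apply]
      ring
    · intro p hp
      have : g p = 0 := image_eq_zero_of_notMem_tsupport fun hmem => hp (hUsub (hgU hmem))
      simp [this]
  have hS : ∀ᵐ p ∂μ, w (V.spacetime a p) = 0 := by
    have hne : ∀ᵐ p ∂(volume : Measure (ℝ × E)), p.1 ≠ a := by
      have : ∀ᵐ t ∂(volume : Measure ℝ), t ≠ a := by simp [ae_iff]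
      exact Measure.quasiMeasurePreserving_fst.ae this
    rw [hμ, ae_restrict_iff' (measurableSet_Ico.prod MeasurableSet.univ)]
    filter_upwards [hU, hne] with p hp hpa hps
    exact hp ⟨⟨lt_of_le_of_ne hps.1.1 (Ne.symm hpa), hps.1.2⟩, mem_univ _⟩
  have hS' : ∀ᵐ p ∂(μ.map (V.spacetime a)), w p = 0 := by
    rwa [(V.spacetime a).measurableEmbedding.ae_map_iff]
  rwa [hmp.map_eq] at hS'

end VolumePreservingFlow
end Transport

/-! ### Concatenation of flows -/

section Concatenation

variable {d : ℕ}

local notation "E" => EuclideanSpace ℝ (Fin d)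

namespace VolumePreservingDiffeo

/-- The identity diffeomorphism. -/
def refl (d : ℕ) : VolumePreservingDiffeo d where
  toHomeo := Homeomorph.refl _
  contDiff := contDiff_id
  contDiff_symm := contDiff_id
  measurePreserving := MeasurePreserving.id _

/-- The composition `x ↦ f (e x)`. -/
def trans (e f : VolumePreservingDiffeo d) : VolumePreservingDiffeo d where
  toHomeo := e.toHomeo.trans f.toHomeo
  contDiff := f.contDiff.comp e.contDiff
  contDiff_symm := e.contDiff_symm.comp f.contDiff_symm
  measurePreserving := f.measurePreserving.comp e.measurePreserving

/-- A diffeomorphism which is the identity off `B` maps any set containing `B` into itself. -/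
lemma mapsTo_of_eq_self (e : VolumePreservingDiffeo d) {B s : Set E}
    (hB : ∀ x ∉ B, e.toHomeo x = x) (hs : B ⊆ s) : MapsTo e.toHomeo s s := by
  intro x hx
  by_contra hy
  have h1 : e.toHomeo (e.toHomeo x) = e.toHomeo x := hB _ fun h => hy (hs h)
  rw [e.toHomeo.injective h1] at hy
  exact hy hx

lemma eLpNorm_comp_le (e : VolumePreservingDiffeo d) {f : E → ℝ} (hf : MemL2loc f) {s : Set E}
    (hs : MapsTo e.toHomeo s s) :
    eLpNorm (fun x => f (e.toHomeo x)) 2 (volume.restrict s) ≤ eLpNorm f 2 (volume.restrict s) := by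
  have h := eLpNorm_comp_measurePreserving (p := 2)
    (hf.aestronglyMeasurable.mono_measure
      (Measure.restrict_le_self (s := e.toHomeo '' s))) (e.measurePreserving_restrict s)
  rw [Function.comp_def] at h
  rw [h]
  exact eLpNorm_mono_measure _ (Measure.restrict_mono hs.image_subset le_rfl)

end VolumePreservingDiffeo

/-- The truncation of `s` to the interval `[0, 1]`. -/
def unitClamp (s : ℝ) : ℝ := max 0 (min 1 s)

lemma unitClamp_of_nonpos {s : ℝ} (h : s ≤ 0) : unitClamp s = 0 := by
  simp [unitClamp, h]

lemma unitClamp_of_one_le {s : ℝ} (h : 1 ≤ s) : unitClamp s = 1 := by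
  simp [unitClamp, h]

lemma unitClamp_of_mem {s : ℝ} (h : s ∈ Icc (0 : ℝ) 1) : unitClamp s = s := by
  simp [unitClamp, h.1, h.2]

lemma continuous_unitClamp : Continuous unitClamp := by
  unfold unitClamp; fun_prop

/-- The backward flow of the field that equals the field of `Φ k` during `[k, k + 1)`, for
`k < n`, and vanishes afterwards: it sends a position at time `t` to the initial position. The time
spent in each flow is truncated, which makes the map jointly continuous in `t` and `x`. -/
noncomputable def backwardFlow (Φ : ℕ → VolumePreservingFlow d) :
    ℕ → ℝ → VolumePreservingDiffeo d
  | 0, _ => VolumePreservingDiffeo.refl d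
  | n + 1, t => ((Φ n).diffeo (-unitClamp (t - n))).trans (backwardFlow Φ n t)

/-- The initial datum `θ₀` transported by the flows `Φ 0, Φ 1, …`, each during unit time. -/
noncomputable def transported (Φ : ℕ → VolumePreservingFlow d)
    (θ₀ : EuclideanSpace ℝ (Fin d) → ℝ) (t : ℝ) (x : EuclideanSpace ℝ (Fin d)) : ℝ :=
  θ₀ ((backwardFlow Φ (⌊t⌋₊ + 1) t).toHomeo x)

variable {Φ : ℕ → VolumePreservingFlow d}

lemma backwardFlow_succ_apply (n : ℕ) (t : ℝ) (x : E) :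
    (backwardFlow Φ (n + 1) t).toHomeo x =
      (backwardFlow Φ n t).toHomeo ((Φ n).flow (-unitClamp (t - n)) x) := rfl

lemma backwardFlow_eq_of_le {n m : ℕ} {t : ℝ} (ht : t ≤ n) (hnm : n ≤ m) (x : E) :
    (backwardFlow Φ m t).toHomeo x = (backwardFlow Φ n t).toHomeo x := by
  induction m, hnm using Nat.le_induction with
  | base => rfl
  | succ m hm ih =>
    have : t - m ≤ 0 := sub_nonpos.2 (ht.trans (Nat.cast_le.2 hm))
    rw [backwardFlow_succ_apply, unitClamp_of_nonpos this, neg_zero, (Φ m).flow_zero, ih]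

lemma backwardFlow_eq_of_ge {n : ℕ} {s t : ℝ} (hs : (n : ℝ) ≤ s) (ht : (n : ℝ) ≤ t) (x : E) :
    (backwardFlow Φ n s).toHomeo x = (backwardFlow Φ n t).toHomeo x := by
  induction n generalizing x with
  | zero => rfl
  | succ n ih =>
    push_cast at hs ht
    rw [backwardFlow_succ_apply, backwardFlow_succ_apply, unitClamp_of_one_le (by linarith),
      unitClamp_of_one_le (by linarith), ih (by linarith) (by linarith)]

lemma backwardFlow_of_notMem {B : Set E} (hB : ∀ n t, ∀ x ∉ B, (Φ n).flow t x = x) (n : ℕ) (t : ℝ)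
    {x : E} (hx : x ∉ B) : (backwardFlow Φ n t).toHomeo x = x := by
  induction n with
  | zero => rfl
  | succ n ih => rw [backwardFlow_succ_apply, hB n _ x hx, ih]

lemma continuous_backwardFlow (n : ℕ) :
    Continuous fun p : ℝ × E => (backwardFlow Φ n p.1).toHomeo p.2 := by
  induction n with
  | zero => exact continuous_snd
  | succ n ih =>
    simp only [backwardFlow_succ_apply]
    have h : Continuous fun p : ℝ × E => (Φ n).flow (-unitClamp (p.1 - n)) p.2 :=
      (Φ n).continuous_flow_comp
        (continuous_unitClamp.comp (by fun_prop : Continuous fun p : ℝ × E => p.1 - n)).neg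
        continuous_snd
    exact ih.comp (continuous_fst.prodMk h)

lemma transported_eq_of_le {θ₀ : E → ℝ} {n : ℕ} {t : ℝ} (ht : t ≤ n) (x : E) :
    transported Φ θ₀ t x = θ₀ ((backwardFlow Φ n t).toHomeo x) := by
  rw [transported]
  congr 1
  have h : t ≤ ((⌊t⌋₊ + 1 : ℕ) : ℝ) := by exact_mod_cast (Nat.lt_floor_add_one t).le
  rcases le_total n (⌊t⌋₊ + 1) with hn | hn
  · exact backwardFlow_eq_of_le ht hn x
  · exact (backwardFlow_eq_of_le h hn x).symm

/-- During `[n, n + 1]` the solution is carried by the flow of `Φ n`. -/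
lemma transported_eq_flow {θ₀ : E → ℝ} {n : ℕ} {t : ℝ} (ht : t ∈ Icc (n : ℝ) (n + 1)) (x : E) :
    transported Φ θ₀ t x = transported Φ θ₀ n ((Φ n).flow (-(t - n)) x) := by
  rw [transported_eq_of_le (n := n + 1) (by push_cast; exact ht.2), backwardFlow_succ_apply,
    unitClamp_of_mem ⟨by linarith [ht.1], by linarith [ht.2]⟩, transported_eq_of_le le_rfl,
    backwardFlow_eq_of_ge ht.1 le_rfl]

lemma transported_zero {θ₀ : E → ℝ} (x : E) : transported Φ θ₀ 0 x = θ₀ x :=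
  transported_eq_of_le (n := 0) (by simp) x

lemma memL2loc_transported {θ₀ : E → ℝ} (h : MemL2loc θ₀) (t : ℝ) :
    MemL2loc (transported Φ θ₀ t) := h.comp _

lemma memH1loc_transported {θ₀ : E → ℝ} (h : MemH1loc θ₀) (t : ℝ) :
    MemH1loc (transported Φ θ₀ t) := h.comp _

lemma aestronglyMeasurable_transported {θ₀ : E → ℝ} (h : AEStronglyMeasurable θ₀ volume) :
    AEStronglyMeasurable (fun p : ℝ × E => transported Φ θ₀ p.1 p.2) volume := by
  have hmeas : Measurable fun p : ℝ × E => (backwardFlow Φ (⌊p.1⌋₊ + 1) p.1).toHomeo p.2 := by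
    have h1 : Measurable fun q : ℕ × (ℝ × E) => (backwardFlow Φ q.1 q.2.1).toHomeo q.2.2 :=
      measurable_from_prod_countable_right fun n => (continuous_backwardFlow n).measurable
    have h2 : Measurable fun p : ℝ × E => ((⌊p.1⌋₊ + 1 : ℕ), p) :=
      ((Nat.measurable_floor.comp measurable_fst).add_const 1).prodMk measurable_id
    exact h1.comp h2
  have hq : Measure.QuasiMeasurePreserving
      (fun p : ℝ × E => (backwardFlow Φ (⌊p.1⌋₊ + 1) p.1).toHomeo p.2)
      ((volume : Measure ℝ).prod volume) volume :=
    QuasiMeasurePreserving.prod_of_right hmeas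
      (Eventually.of_forall fun t =>
        (backwardFlow Φ (⌊t⌋₊ + 1) t).measurePreserving.quasiMeasurePreserving)
  exact h.comp_quasiMeasurePreserving hq

lemma eLpNorm_transported_le {B : Set E} (hB : ∀ n t, ∀ x ∉ B, (Φ n).flow t x = x) {θ₀ : E → ℝ}
    (h : MemL2loc θ₀) (K : Set E) (t : ℝ) :
    eLpNorm (transported Φ θ₀ t) 2 (volume.restrict K) ≤
      eLpNorm θ₀ 2 (volume.restrict (K ∪ B)) :=
  (eLpNorm_mono_measure _ (Measure.restrict_mono subset_union_left le_rfl)).trans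
    (VolumePreservingDiffeo.eLpNorm_comp_le _ h
      (VolumePreservingDiffeo.mapsTo_of_eq_self _
        (fun _ hx => backwardFlow_of_notMem hB _ t hx) subset_union_right))

/-- Continuity in time follows from the continuity of composition with measure preserving maps
in `L²(ℝ^d)`, applied to the restriction of `θ₀` to a compact set invariant under the flows. -/
lemma isContinuousInL2loc_transported {B : Set E} (hBc : IsCompact B)
    (hB : ∀ n t, ∀ x ∉ B, (Φ n).flow t x = x) {θ₀ : E → ℝ} (h : MemL2loc θ₀) :
    IsContinuousInL2loc (transported Φ θ₀) := by
  refine ⟨fun t _ => memL2loc_transported h t, fun K hK t _ => ?_⟩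
  have hKB := hK.union hBc
  have hmaps : ∀ n s, MapsTo (backwardFlow Φ n s).toHomeo (K ∪ B) (K ∪ B) := fun n s =>
    VolumePreservingDiffeo.mapsTo_of_eq_self _
      (fun _ hx => backwardFlow_of_notMem hB n s hx) subset_union_right
  have hf : MemLp ((K ∪ B).indicator θ₀) 2 volume :=
    (memLp_indicator_iff_restrict hKB.measurableSet).2 (h _ hKB)
  obtain ⟨N, hN⟩ := exists_nat_gt t
  let g : C(ℝ, C(E, E)) := ContinuousMap.curry ⟨_, continuous_backwardFlow (Φ := Φ) N⟩
  have hg : ∀ s, MeasurePreserving (g s) volume volume := fun s =>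
    (backwardFlow Φ N s).measurePreserving
  have hcont := Continuous.compMeasurePreservingLp (f := fun _ : ℝ => hf.toLp _)
    continuous_const g.continuous hg (by simp)
  have hlim := (tendsto_iff_edist_tendsto_0.1 (hcont.tendsto t))
  refine tendsto_of_tendsto_of_tendsto_of_le_of_le' tendsto_const_nhds
    (hlim.mono_left nhdsWithin_le_nhds) (Eventually.of_forall fun _ => zero_le) ?_
  filter_upwards [nhdsWithin_le_nhds (Iio_mem_nhds hN)] with s hs
  rw [Lp.edist_def]
  have hae : ∀ r, Lp.compMeasurePreserving (g r) (hg r) (hf.toLp _) =ᵐ[volume]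
      fun x => (K ∪ B).indicator θ₀ ((backwardFlow Φ N r).toHomeo x) := fun r =>
    (Lp.coeFn_compMeasurePreserving _ _).trans
      ((hg r).quasiMeasurePreserving.ae_eq_comp hf.coeFn_toLp)
  calc eLpNorm (transported Φ θ₀ s - transported Φ θ₀ t) 2 (volume.restrict K)
      = eLpNorm (fun x => (K ∪ B).indicator θ₀ ((backwardFlow Φ N s).toHomeo x)
          - (K ∪ B).indicator θ₀ ((backwardFlow Φ N t).toHomeo x)) 2 (volume.restrict K) := by
        refine eLpNorm_congr_ae ?_
        filter_upwards [ae_restrict_mem hK.measurableSet] with x hx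
        have hx' : x ∈ K ∪ B := Or.inl hx
        rw [Pi.sub_apply, transported_eq_of_le (le_of_lt hs), transported_eq_of_le hN.le,
          indicator_of_mem (hmaps N s hx'), indicator_of_mem (hmaps N t hx')]
    _ ≤ eLpNorm (fun x => (K ∪ B).indicator θ₀ ((backwardFlow Φ N s).toHomeo x)
          - (K ∪ B).indicator θ₀ ((backwardFlow Φ N t).toHomeo x)) 2 volume :=
        eLpNorm_mono_measure _ Measure.restrict_le_self
    _ = _ := eLpNorm_congr_ae (((hae s).sub (hae t)).symm)

/-- The time-dependent field that equals the field of `Φ n` during `[n, n + 1)`. -/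
noncomputable def stepField (Φ : ℕ → VolumePreservingFlow d) (t : ℝ) :
    EuclideanSpace ℝ (Fin d) → EuclideanSpace ℝ (Fin d) := (Φ ⌊t⌋₊).field

lemma stepField_of_mem {n : ℕ} {t : ℝ} (ht : t ∈ Ico (n : ℝ) (n + 1)) :
    stepField Φ t = (Φ n).field := by
  rw [stepField, (Nat.floor_eq_iff ((Nat.cast_nonneg n).trans ht.1)).2 ht]

lemma isPiecewiseConstantInTime_stepField : IsPiecewiseConstantInTime (stepField Φ) := by
  refine ⟨fun k => k, by simp, Nat.strictMono_cast, tendsto_natCast_atTop_atTop, fun k t ht => ?_⟩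
  rw [stepField_of_mem (by simpa using ht), stepField_of_mem (n := k) (by simp)]

/-- The integrand of the weak transport equation on `[n, n + 1) × ℝ^d`. -/
lemma weak_integrand_slab (w : ℝ × E → ℝ) (ψ : ℝ × E → ℝ) (n : ℕ) :
    EqOn (fun p : ℝ × E => w p * fderiv ℝ ψ p (1, stepField Φ p.1 p.2))
      (fun p => w p * fderiv ℝ ψ p (1, (Φ n).field p.2)) (Ico (n : ℝ) (n + 1) ×ˢ univ) := by
  intro p hp
  simp only [stepField_of_mem hp.1]

lemma measurableSet_slab (a b : ℝ) : MeasurableSet (Ico a b ×ˢ (univ : Set E)) :=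
  measurableSet_Ico.prod MeasurableSet.univ

lemma slab_union (n : ℕ) : Ico (0 : ℝ) ((n + 1 : ℕ) : ℝ) ×ˢ (univ : Set E) =
    Ico (0 : ℝ) n ×ˢ univ ∪ Ico (n : ℝ) (n + 1) ×ˢ univ := by
  rw [← union_prod, Ico_union_Ico_eq_Ico (Nat.cast_nonneg n) (by linarith)]
  push_cast; rfl

lemma slab_disjoint (n : ℕ) : Disjoint (Ico (0 : ℝ) n ×ˢ (univ : Set E))
    (Ico (n : ℝ) (n + 1) ×ˢ univ) := by
  rw [Set.disjoint_left]
  intro p hp hp'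
  exact absurd hp.1.2 (not_lt.2 hp'.1.1)

lemma integrableOn_weak_slab {w : ℝ × E → ℝ}
    (hw : LocallyIntegrable w (volume.restrict (Ici (0 : ℝ) ×ˢ univ)))
    {ψ : ℝ × E → ℝ} (hψ : ContDiff ℝ ∞ ψ) (hψc : HasCompactSupport ψ) (n : ℕ) :
    IntegrableOn (fun p => w p * fderiv ℝ ψ p (1, stepField Φ p.1 p.2))
      (Ico (n : ℝ) (n + 1) ×ˢ univ) :=
  ((Φ n).integrableOn_slab (fun _ ht => (Nat.cast_nonneg n).trans ht.1) hw hψ hψc).congr_fun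
    (weak_integrand_slab w ψ n).symm (measurableSet_slab _ _)

lemma integrableOn_weak {w : ℝ × E → ℝ}
    (hw : LocallyIntegrable w (volume.restrict (Ici (0 : ℝ) ×ˢ univ)))
    {ψ : ℝ × E → ℝ} (hψ : ContDiff ℝ ∞ ψ) (hψc : HasCompactSupport ψ) (n : ℕ) :
    IntegrableOn (fun p => w p * fderiv ℝ ψ p (1, stepField Φ p.1 p.2))
      (Ico (0 : ℝ) n ×ˢ univ) := by
  induction n with
  | zero => simp
  | succ n ih =>
    rw [slab_union]
    exact ih.union (integrableOn_weak_slab hw hψ hψc n)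

/-- The weak formulation only sees the times before the support of the test function ends. -/
lemma setIntegral_weak_eq {ψ : ℝ × E → ℝ} {n : ℕ} (hn : tsupport ψ ⊆ {p | p.1 < n})
    (u : ℝ → E → E) (w : ℝ × E → ℝ) :
    ∫ p in Ici (0 : ℝ) ×ˢ univ, w p * fderiv ℝ ψ p (1, u p.1 p.2) =
      ∫ p in Ico (0 : ℝ) n ×ˢ univ, w p * fderiv ℝ ψ p (1, u p.1 p.2) := by
  refine setIntegral_eq_of_subset_of_forall_sdiff_eq_zero
    (measurableSet_Ici.prod MeasurableSet.univ) (prod_mono Ico_subset_Ici_self le_rfl) ?_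
  intro p hp
  have : p ∉ tsupport ψ := fun h => hp.2 ⟨⟨hp.1.1, hn h⟩, mem_univ _⟩
  have h0 : fderiv ℝ ψ p = 0 :=
    image_eq_zero_of_notMem_tsupport fun h => this (tsupport_fderiv_subset ℝ h)
  simp [h0]

lemma exists_nat_tsupport_subset {ψ : ℝ × E → ℝ} (hψc : HasCompactSupport ψ) :
    ∃ n : ℕ, tsupport ψ ⊆ {p | p.1 < n} := by
  obtain ⟨b, hb⟩ := (hψc.isCompact.image continuous_fst).bddAbove
  obtain ⟨n, hn⟩ := exists_nat_gt b
  exact ⟨n, fun p hp => (hb ⟨p, hp, rfl⟩).trans_lt hn⟩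

/-- The transported datum is a weak solution: the contributions of the slabs telescope. -/
theorem isWeakTransportSolution_transported {B : Set E} (hBc : IsCompact B)
    (hB : ∀ n t, ∀ x ∉ B, (Φ n).flow t x = x) {θ₀ : E → ℝ} (h : MemL2loc θ₀) :
    IsWeakTransportSolution (stepField Φ) θ₀ (transported Φ θ₀) := by
  have hm : AEStronglyMeasurable (fun p : ℝ × E => transported Φ θ₀ p.1 p.2)
      (volume.restrict (Ici (0 : ℝ) ×ˢ univ)) :=
    (aestronglyMeasurable_transported h.aestronglyMeasurable).mono_measure Measure.restrict_le_self
  have hb : ∀ K : Set E, IsCompact K → ∃ M : ℝ≥0, ∀ᵐ t ∂(volume.restrict (Ici (0 : ℝ))),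
      eLpNorm (transported Φ θ₀ t) 2 (volume.restrict K) ≤ M := fun K hK =>
    ⟨(eLpNorm θ₀ 2 (volume.restrict (K ∪ B))).toNNReal, Eventually.of_forall fun t => by
      rw [ENNReal.coe_toNNReal (h _ (hK.union hBc)).2.ne]
      exact eLpNorm_transported_le hB h K t⟩
  refine ⟨hm, hb, fun ψ hψ hψc => ?_⟩
  have hloc := locallyIntegrable_of_eLpNorm_bounded hm hb
  have hslab : ∀ n : ℕ, ∫ p in Ico (n : ℝ) (n + 1) ×ˢ univ,
      transported Φ θ₀ p.1 p.2 * fderiv ℝ ψ p (1, stepField Φ p.1 p.2) =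
      (∫ x, transported Φ θ₀ (n + 1 : ℕ) x * ψ ((n + 1 : ℕ), x))
        - ∫ x, transported Φ θ₀ n x * ψ (n, x) := fun n => by
    have h1 := (Φ n).integral_slab (memL2loc_transported (Φ := Φ) h n).locallyIntegrable
      (a := n) (b := n + 1) (by linarith) hψ hψc
    have h2 : ∀ x, transported Φ θ₀ (n + 1 : ℕ) x
        = transported Φ θ₀ n ((Φ n).flow (-((n : ℝ) + 1 - n)) x) := fun x => by
      rw [transported_eq_flow (n := n) (by push_cast; simp)]
      push_cast; rfl
    simp_rw [h2]
    push_cast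
    rw [← h1]
    refine setIntegral_congr_fun (measurableSet_slab _ _) fun p hp => ?_
    simp only [stepField_of_mem hp.1, transported_eq_flow (θ₀ := θ₀) (Ico_subset_Icc_self hp.1)]
  have hsum : ∀ n : ℕ, ∫ p in Ico (0 : ℝ) n ×ˢ univ,
      transported Φ θ₀ p.1 p.2 * fderiv ℝ ψ p (1, stepField Φ p.1 p.2) =
      (∫ x, transported Φ θ₀ n x * ψ (n, x)) - ∫ x, θ₀ x * ψ (0, x) := fun n => by
    induction n with
    | zero => simp [transported_zero]
    | succ n ih =>
      rw [slab_union, setIntegral_union (slab_disjoint n) (measurableSet_slab _ _)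
        (integrableOn_weak hloc hψ hψc n) (integrableOn_weak_slab hloc hψ hψc n), ih, hslab]
      ring
  obtain ⟨N, hN⟩ := exists_nat_tsupport_subset hψc
  rw [setIntegral_weak_eq hN (stepField Φ) fun p => transported Φ θ₀ p.1 p.2, hsum N]
  have hz : ∀ x, ψ ((N : ℝ), x) = 0 := fun x =>
    image_eq_zero_of_notMem_tsupport fun hmem => lt_irrefl (N : ℝ) (hN hmem)
  simp [hz]

/-- Weak solutions are unique: their difference vanishes on one slab after the other. -/
theorem IsWeakTransportSolution.ae_eq {θ₀ : E → ℝ} {θ η : ℝ → E → ℝ}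
    (hθ : IsWeakTransportSolution (stepField Φ) θ₀ θ)
    (hη : IsWeakTransportSolution (stepField Φ) θ₀ η) :
    ∀ᵐ t ∂(volume.restrict (Ici (0 : ℝ))), η t =ᵐ[volume] θ t := by
  have hθl := locallyIntegrable_of_eLpNorm_bounded hθ.aestronglyMeasurable hθ.bounded
  have hηl := locallyIntegrable_of_eLpNorm_bounded hη.aestronglyMeasurable hη.bounded
  set w : ℝ × E → ℝ := fun p => η p.1 p.2 - θ p.1 p.2 with hw_def
  have hw : LocallyIntegrable w (volume.restrict (Ici (0 : ℝ) ×ˢ univ)) := hηl.sub hθl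
  have hweak : ∀ ψ : ℝ × E → ℝ, ContDiff ℝ ∞ ψ → HasCompactSupport ψ → ∀ n : ℕ,
      tsupport ψ ⊆ {p | p.1 < n} →
      ∫ p in Ico (0 : ℝ) n ×ˢ univ, w p * fderiv ℝ ψ p (1, stepField Φ p.1 p.2) = 0 := by
    intro ψ hψ hψc n hn
    have h1 := hθ.weak_eq ψ hψ hψc
    have h2 := hη.weak_eq ψ hψ hψc
    rw [setIntegral_weak_eq hn _ fun p => θ p.1 p.2] at h1
    rw [setIntegral_weak_eq hn _ fun p => η p.1 p.2] at h2
    simp_rw [hw_def, sub_mul]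
    rw [integral_sub (integrableOn_weak hηl hψ hψc n) (integrableOn_weak hθl hψ hψc n)]
    linarith
  have hzero : ∀ n : ℕ, ∀ᵐ p ∂(volume.restrict (Ico (0 : ℝ) n ×ˢ univ)), w p = 0 := by
    intro n
    induction n with
    | zero => simp
    | succ n ih =>
      rw [slab_union, ae_restrict_union_iff]
      refine ⟨ih, (Φ n).ae_eq_zero_on_slab (Nat.cast_nonneg n) (by linarith) hw ?_⟩
      intro ψ hψ hψc hψs
      have h1 := hweak ψ hψ hψc (n + 1) (by push_cast; exact hψs)
      rw [slab_union, setIntegral_union (slab_disjoint n) (measurableSet_slab _ _)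
        (integrableOn_weak hw hψ hψc n) (integrableOn_weak_slab hw hψ hψc n),
        setIntegral_congr_fun (measurableSet_slab _ _) (weak_integrand_slab w ψ n)] at h1
      have h2 : ∫ p in Ico (0 : ℝ) n ×ˢ univ, w p * fderiv ℝ ψ p (1, stepField Φ p.1 p.2) = 0 :=
        integral_eq_zero_of_ae (by filter_upwards [ih] with p hp; simp [hp])
      rwa [h2, zero_add] at h1
  have hall : ∀ᵐ p ∂((volume.restrict (Ici (0 : ℝ))).prod (volume : Measure E)), w p = 0 := by
    have hcover : Ici (0 : ℝ) ×ˢ (univ : Set E) = ⋃ n : ℕ, Ico (0 : ℝ) n ×ˢ univ := by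
      ext p
      simp only [mem_prod, mem_Ici, mem_univ, and_true, mem_iUnion, mem_Ico]
      exact ⟨fun h => (exists_nat_gt p.1).imp fun n hn => ⟨h, hn⟩, fun ⟨_, h, _⟩ => h⟩
    have := (ae_restrict_iUnion_iff (μ := volume) (fun n : ℕ => Ico (0 : ℝ) n ×ˢ (univ : Set E))
      fun p => w p = 0).2 hzero
    rw [← hcover, Measure.volume_eq_prod, ← Measure.prod_restrict, Measure.restrict_univ] at this
    exact this
  filter_upwards [Measure.ae_ae_of_ae_prod hall] with t ht
  filter_upwards [ht] with x hx
  exact sub_eq_zero.1 hx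

end Concatenation

/-! ### Swirls in coordinate planes -/

section PlanarSwirl

variable {d : ℕ}

local notation "E" => EuclideanSpace ℝ (Fin d)

/-- The generator `v ↦ vᵢ eⱼ - vⱼ eᵢ` of the rotations of the `(i, j)` coordinate plane. -/
noncomputable def planeGenerator (i j : Fin d) :
    EuclideanSpace ℝ (Fin d) →L[ℝ] EuclideanSpace ℝ (Fin d) :=
  (EuclideanSpace.proj i).smulRight (EuclideanSpace.single j (1 : ℝ)) -
    (EuclideanSpace.proj j).smulRight (EuclideanSpace.single i (1 : ℝ))

lemma planeGenerator_apply (i j k : Fin d) (v : E) :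
    planeGenerator i j v k = (if k = j then v i else 0) - (if k = i then v j else 0) := by
  simp [planeGenerator]

variable {i j : Fin d}

lemma planeGenerator_left (hij : i ≠ j) (v : E) : planeGenerator i j v i = -v j := by
  simp [planeGenerator_apply, hij]

lemma planeGenerator_right (hij : i ≠ j) (v : E) : planeGenerator i j v j = v i := by
  simp [planeGenerator_apply, hij.symm]

lemma planeGenerator_other {k : Fin d} (hi : k ≠ i) (hj : k ≠ j) (v : E) :
    planeGenerator i j v k = 0 := by
  simp [planeGenerator_apply, hi, hj]

lemma inner_planeGenerator (v w : E) :
    inner ℝ (planeGenerator i j v) w = v i * w j - v j * w i := by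
  simp [planeGenerator, inner_sub_left, inner_smul_left, EuclideanSpace.inner_single_left]

lemma isRotationGenerator_planeGenerator (hij : i ≠ j) :
    IsRotationGenerator (planeGenerator i j) where
  skew x y := by
    rw [real_inner_comm (planeGenerator i j y) x, inner_planeGenerator, inner_planeGenerator]
    ring
  cube x := by
    ext k
    by_cases hi : k = i
    · subst hi; simp [planeGenerator_left hij, planeGenerator_right hij]
    · by_cases hj : k = j
      · subst hj; simp [planeGenerator_left hij, planeGenerator_right hij]
      · simp [planeGenerator_other hi hj]

lemma norm_sq_planeGenerator (hij : i ≠ j) (v : E) :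
    ‖planeGenerator i j v‖ ^ 2 = v i ^ 2 + v j ^ 2 := by
  rw [← real_inner_self_eq_norm_sq, inner_planeGenerator, planeGenerator_left hij,
    planeGenerator_right hij]
  ring

/-- A smooth function which is `1` on `[0, 1]^d` and vanishes off `(-1, 2)^d`. -/
noncomputable def cubeCutoff (x : EuclideanSpace ℝ (Fin d)) : ℝ :=
  ∏ k, (Real.smoothTransition (x k + 1) * Real.smoothTransition (2 - x k))

lemma contDiff_cubeCutoff : ContDiff ℝ ∞ (cubeCutoff (d := d)) := by
  unfold cubeCutoff
  refine contDiff_prod fun k _ => ?_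
  exact (Real.smoothTransition.contDiff.comp (by fun_prop)).mul
    (Real.smoothTransition.contDiff.comp (by fun_prop))

lemma cubeCutoff_eq_one {x : E} (h : ∀ k, x k ∈ Icc (0 : ℝ) 1) : cubeCutoff x = 1 :=
  Finset.prod_eq_one fun k _ => by
    rw [Real.smoothTransition.one_of_one_le (by linarith [(h k).1]),
      Real.smoothTransition.one_of_one_le (by linarith [(h k).2]), one_mul]

lemma mem_of_cubeCutoff_ne_zero {x : E} (h : cubeCutoff x ≠ 0) (k : Fin d) :
    x k ∈ Icc (-1 : ℝ) 2 := by
  have hk := Finset.prod_ne_zero_iff.1 h k (Finset.mem_univ k)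
  constructor <;> by_contra hcon <;> apply hk
  · rw [Real.smoothTransition.zero_of_nonpos (by linarith), zero_mul]
  · rw [Real.smoothTransition.zero_of_nonpos (x := 2 - x k) (by linarith), mul_zero]

/-- The angular velocity profile, as a function of the squared distance `r` to the axis: half a turn
per unit time, plus a small oscillation of high frequency `N`. -/
noncomputable def swirlAngle (N φ r : ℝ) : ℝ := Real.pi + 1 / 16 * Real.sin (N * r + φ)

/-- The swirl about `c` in the `(i, j)` coordinate plane with profile `swirlAngle N φ`, cut off at
distance of order one from the centre and away from the unit cube. The last factor is evaluated at
the point `x` with the coordinates `i` and `j` replaced by those of `c`, which the rotations about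
`c` do not change. -/
noncomputable def planarSwirl (hij : i ≠ j) (N φ : ℝ) (c : EuclideanSpace ℝ (Fin d)) : Swirl d where
  gen := planeGenerator i j
  center := c
  speed x := swirlAngle N φ (‖planeGenerator i j (x - c)‖ ^ 2) *
    Real.smoothTransition (3 - ‖planeGenerator i j (x - c)‖ ^ 2) *
    cubeCutoff (c + ((x - c) + planeGenerator i j (planeGenerator i j (x - c))))
  isGen := isRotationGenerator_planeGenerator hij
  contDiff_speed := by
    have hJ : ContDiff ℝ ∞ fun x : E => planeGenerator i j (x - c) := by fun_prop
    have h1 : ContDiff ℝ ∞ fun x : E => ‖planeGenerator i j (x - c)‖ ^ 2 := hJ.norm_sq ℝ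
    have h2 : ContDiff ℝ ∞ (swirlAngle N φ) := by
      unfold swirlAngle
      exact contDiff_const.add (contDiff_const.mul (Real.contDiff_sin.comp (by fun_prop)))
    exact ((h2.comp h1).mul (Real.smoothTransition.contDiff.comp (contDiff_const.sub h1))).mul
      (contDiff_cubeCutoff.comp (by fun_prop))
  speed_rot a z := by
    have hJ := isRotationGenerator_planeGenerator hij
    have hn : ‖planeGenerator i j (rodrigues (planeGenerator i j) a z)‖ =
        ‖planeGenerator i j z‖ := by
      rw [map_rodrigues, hJ.norm_rodrigues]
    simp only [add_sub_cancel_left, hn, hJ.add_sq_rodrigues]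

lemma add_sq_planeGenerator_apply (hij : i ≠ j) (c x : E) (k : Fin d) :
    (c + ((x - c) + planeGenerator i j (planeGenerator i j (x - c)))) k =
      if k = i ∨ k = j then c k else x k := by
  by_cases hi : k = i
  · subst hi; simp [planeGenerator_left hij, planeGenerator_right hij]
  · by_cases hj : k = j
    · subst hj; simp [planeGenerator_left hij, planeGenerator_right hij]
    · simp [planeGenerator_other hi hj, hi, hj]

lemma mem_of_speed_planarSwirl_ne_zero (hij : i ≠ j) (N φ : ℝ) {c : E} (hc : ∀ k, c k ∈ Icc (0 : ℝ) 1) {x : E}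
    (h : (planarSwirl hij N φ c).speed x ≠ 0) (k : Fin d) : x k ∈ Icc (-2 : ℝ) 3 := by
  have h1 := mem_of_cubeCutoff_ne_zero (right_ne_zero_of_mul h) k
  have h2 := right_ne_zero_of_mul (left_ne_zero_of_mul h)
  have h3 : ‖planeGenerator i j (x - c)‖ ^ 2 < 3 := by
    by_contra hcon
    exact h2 (Real.smoothTransition.zero_of_nonpos (by linarith))
  rw [norm_sq_planeGenerator hij] at h3
  rw [add_sq_planeGenerator_apply hij] at h1
  have h4 : k = i ∨ k = j → (x k - c k) ^ 2 ≤ 2 ^ 2 := by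
    simp only [PiLp.sub_apply] at h3
    rintro (rfl | rfl)
    · nlinarith [sq_nonneg (x j - c j)]
    · nlinarith [sq_nonneg (x i - c i)]
  by_cases hk : k = i ∨ k = j
  · have h5 := abs_le_of_sq_le_sq' (h4 hk) (by norm_num)
    have h6 := hc k
    exact ⟨by linarith [h5.1, h6.1], by linarith [h5.2, h6.2]⟩
  · rw [if_neg hk] at h1
    exact ⟨by linarith [h1.1], by linarith [h1.2]⟩

lemma speed_planarSwirl_eq (hij : i ≠ j) (N φ : ℝ) {c : E} (hc : ∀ k, c k ∈ Icc (0 : ℝ) 1) {x : E} (hx : x ∈ openCube d 0 1)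
    (hr : ‖planeGenerator i j (x - c)‖ ^ 2 < 2) :
    (planarSwirl hij N φ c).speed x = swirlAngle N φ (‖planeGenerator i j (x - c)‖ ^ 2) := by
  have h1 : cubeCutoff (c + ((x - c) + planeGenerator i j (planeGenerator i j (x - c)))) = 1 := by
    refine cubeCutoff_eq_one fun k => ?_
    rw [add_sq_planeGenerator_apply hij]
    split_ifs
    · exact hc k
    · exact Ioo_subset_Icc_self (hx k)
  have h2 : Real.smoothTransition (3 - ‖planeGenerator i j (x - c)‖ ^ 2) = 1 :=
    Real.smoothTransition.one_of_one_le (by linarith)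
  simp only [planarSwirl, h1, h2, mul_one]

lemma isOpen_openCube (a b : ℝ) : IsOpen (openCube d a b) := by
  have : openCube d a b = ⋂ k, {x | x k ∈ Ioo a b} := by ext; simp [openCube]
  rw [this]
  exact isOpen_iInter_of_finite fun k => isOpen_Ioo.preimage (by fun_prop)

lemma fderiv_speed_planarSwirl (hij : i ≠ j) (N φ : ℝ) {c : E}
    (hc : ∀ k, c k ∈ Icc (0 : ℝ) 1) {x : E} (hx : x ∈ openCube d 0 1)
    (hr : ‖planeGenerator i j (x - c)‖ ^ 2 < 2) (w : E) :
    fderiv ℝ (planarSwirl hij N φ c).speed x w =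
      inner ℝ (-(N / 8 * Real.cos (N * ‖planeGenerator i j (x - c)‖ ^ 2 + φ)) •
        planeGenerator i j (planeGenerator i j (x - c))) w := by
  have hJ := isRotationGenerator_planeGenerator hij
  have hcont : Continuous fun x : E => ‖planeGenerator i j (x - c)‖ ^ 2 := by fun_prop
  have heq : (planarSwirl hij N φ c).speed =ᶠ[𝓝 x]
      swirlAngle N φ ∘ fun x => ‖planeGenerator i j (x - c)‖ ^ 2 := by
    filter_upwards [(isOpen_openCube 0 1).mem_nhds hx,
      (isOpen_lt hcont continuous_const).mem_nhds hr] with y hy hyr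
    exact speed_planarSwirl_eq hij N φ hc hy hyr
  have h1 : HasFDerivAt (fun x : E => planeGenerator i j (x - c)) (planeGenerator i j) x := by
    have := (planeGenerator i j).hasFDerivAt.comp x ((hasFDerivAt_id x).sub_const c)
    exact this
  have h2 := h1.norm_sq
  have h3 : HasDerivAt (swirlAngle N φ)
      (1 / 16 * (Real.cos (N * ‖planeGenerator i j (x - c)‖ ^ 2 + φ) * N))
      (‖planeGenerator i j (x - c)‖ ^ 2) := by
    have e1 : HasDerivAt (fun r : ℝ => N * r + φ) N (‖planeGenerator i j (x - c)‖ ^ 2) := by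
      simpa using ((hasDerivAt_id _).const_mul N).add_const φ
    exact (e1.sin.const_mul (1 / 16)).const_add Real.pi
  rw [heq.fderiv_eq, (h3.comp_hasFDerivAt x h2).fderiv]
  have h4 := hJ.sq_inner (x - c) w
  simp only [inner_neg_left, inner_smul_left, neg_smul]
  simp [h4, -map_sub]
  ring

end PlanarSwirl

section Growth

variable {d : ℕ}

local notation "E" => EuclideanSpace ℝ (Fin d)

/-- How the flow of a swirl at time `1` acts on gradients. If `G` is the gradient of the angular
velocity at `y`, the derivative of the flow is `R (1 + (J z) ⊗ G)`, with `R` a rotation and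
`G ⊥ J z`, so its inverse transpose sends `g` to `R (g - ⟪g, J z⟫ G)`. -/
lemma Swirl.norm_adjoint_fderiv_flow (S : Swirl d) {y G : E}
    (hG : ∀ w, fderiv ℝ S.speed y w = inner ℝ G w) (g : E) :
    ‖ContinuousLinearMap.adjoint (fderiv ℝ (S.flow (-1)) (S.flow 1 y)) g‖ =
      ‖g - inner ℝ g (S.gen (y - S.center)) • G‖ := by
  set h := ContinuousLinearMap.adjoint (fderiv ℝ (S.flow (-1)) (S.flow 1 y)) g
  set J := S.gen
  set z := y - S.center
  have h1 : ∀ v, fderiv ℝ (S.flow (-1)) (S.flow 1 y) (fderiv ℝ (S.flow 1) y v) = v := by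
    have := (S.toFlow.diffeo 1).fderiv_symm_comp y
    exact this
  have h2 : ∀ v, inner ℝ h (rodrigues J (1 * S.speed y) (v + fderiv ℝ S.speed y v • J z))
      = inner ℝ g v := fun v => by
    rw [ContinuousLinearMap.adjoint_inner_left]
    conv_rhs => rw [← h1 v, (S.hasFDerivAt_flow 1 y).fderiv]
    simp [J, z]
  have hperp : fderiv ℝ S.speed y (J z) = 0 := S.fderiv_speed_gen y
  have h3 : rodrigues J (-S.speed y) h = g - inner ℝ g (J z) • G := by
    refine ext_inner_right ℝ fun w => ?_
    have h4 := h2 (w - fderiv ℝ S.speed y w • J z)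
    have h5 : fderiv ℝ S.speed y (w - fderiv ℝ S.speed y w • J z) = fderiv ℝ S.speed y w := by
      rw [map_sub, map_smul, hperp, smul_zero, sub_zero]
    rw [h5, sub_add_cancel, one_mul, inner_sub_right, inner_smul_right, hG] at h4
    rw [S.isGen.inner_rodrigues, neg_neg, h4, inner_sub_left, inner_smul_left]
    simp; ring
  rw [← S.isGen.norm_rodrigues (-S.speed y) h, h3]

/-- Over four phases a quarter period apart, `cos` sums to `0` and `cos²` to `2`, so that the cross
terms cancel and the quadratic terms have no zeros. -/
lemma sum_norm_sq_sub_cos_smul (g v : E) (a K s : ℝ) :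
    ∑ m : Fin 4, ‖g - a • (-(K * Real.cos (s + (m : ℕ) * (Real.pi / 2)))) • v‖ ^ 2 =
      4 * ‖g‖ ^ 2 + 2 * K ^ 2 * (a ^ 2 * ‖v‖ ^ 2) := by
  have h1 : ∀ κ : ℝ, ‖g - a • (-(K * κ)) • v‖ ^ 2 =
      ‖g‖ ^ 2 + 2 * a * K * inner ℝ g v * κ + K ^ 2 * a ^ 2 * ‖v‖ ^ 2 * κ ^ 2 := fun κ => by
    rw [norm_sub_sq_real, norm_smul, norm_smul, inner_smul_right, inner_smul_right, mul_pow,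
      mul_pow, Real.norm_eq_abs, Real.norm_eq_abs, sq_abs, sq_abs]
    ring
  have c1 : Real.cos (s + Real.pi / 2) = -Real.sin s := Real.cos_add_pi_div_two s
  have c2 : Real.cos (s + 2 * (Real.pi / 2)) = -Real.cos s := by
    rw [mul_div_cancel₀ _ two_ne_zero, Real.cos_add_pi]
  have c3 : Real.cos (s + 3 * (Real.pi / 2)) = Real.sin s := by
    rw [show s + 3 * (Real.pi / 2) = s + Real.pi / 2 + Real.pi by ring, Real.cos_add_pi,
      Real.cos_add_pi_div_two, neg_neg]
  simp only [h1, Fin.sum_univ_four, Fin.val_zero, Fin.val_one, Fin.val_two, Nat.cast_zero, zero_mul,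
    add_zero, Nat.cast_one, one_mul, Nat.cast_ofNat, c1, c2,
    show ((3 : Fin 4) : ℕ) = 3 from rfl, c3]
  linear_combination (2 * K ^ 2 * a ^ 2 * ‖v‖ ^ 2) * Real.sin_sq_add_cos_sq s

/-- The sign `±1` encoded by a Boolean. -/
def boolSign (b : Bool) : ℝ := if b then 1 else -1

lemma boolSign_mem (b : Bool) : boolSign b ∈ Icc (-1 : ℝ) 1 := by
  cases b <;> simp [boolSign]

/-- Four rotation centres at the vertices of a square of side `1/4` see every direction `(s, t)`:
the factor `(z₁ t - z₂ s) |z|` cannot be small for all four. By Cauchy-Schwarz it suffices to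
bound the sum of the fourth powers of `z₁ t - z₂ s`. -/
lemma sum_four_centers (a b s t : ℝ) :
    (s ^ 2 + t ^ 2) / 1024 ≤ ∑ σ : Bool, ∑ τ : Bool,
      ((a - boolSign σ / 8) * t - (b - boolSign τ / 8) * s) ^ 2 *
        ((a - boolSign σ / 8) ^ 2 + (b - boolSign τ / 8) ^ 2) := by
  have hcs : ∀ σ τ : Bool, ((a - boolSign σ / 8) * t - (b - boolSign τ / 8) * s) ^ 4 ≤
      ((a - boolSign σ / 8) * t - (b - boolSign τ / 8) * s) ^ 2 *
        ((a - boolSign σ / 8) ^ 2 + (b - boolSign τ / 8) ^ 2) * (s ^ 2 + t ^ 2) := fun σ τ => by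
    generalize a - boolSign σ / 8 = x
    generalize b - boolSign τ / 8 = y
    have h : (x * t - y * s) ^ 2 ≤ (x ^ 2 + y ^ 2) * (s ^ 2 + t ^ 2) := by
      nlinarith [sq_nonneg (x * s + y * t)]
    calc (x * t - y * s) ^ 4 = (x * t - y * s) ^ 2 * (x * t - y * s) ^ 2 := by ring
      _ ≤ (x * t - y * s) ^ 2 * ((x ^ 2 + y ^ 2) * (s ^ 2 + t ^ 2)) :=
        mul_le_mul_of_nonneg_left h (sq_nonneg _)
      _ = _ := by ring
  have hquart : ∀ A v : ℝ, 2 * v ^ 4 ≤ (A - v) ^ 4 + (A + v) ^ 4 := fun A v => by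
    have : (A - v) ^ 4 + (A + v) ^ 4 = 2 * v ^ 4 + (2 * A ^ 4 + 12 * (A * v) ^ 2) := by ring
    rw [this]
    have : 0 ≤ 2 * A ^ 4 + 12 * (A * v) ^ 2 := by positivity
    linarith
  rcases (add_nonneg (sq_nonneg s) (sq_nonneg t)).eq_or_lt with hQ | hQ
  · rw [← hQ, zero_div]
    exact Finset.sum_nonneg fun σ _ => Finset.sum_nonneg fun τ _ => by positivity
  · refine le_of_mul_le_mul_right ?_ hQ
    have h1 := hquart (a * t - b * s) ((t - s) / 8)
    have h2 := hquart (a * t - b * s) ((t + s) / 8)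
    have h3 : (s ^ 2 + t ^ 2) / 1024 * (s ^ 2 + t ^ 2) ≤
        2 * ((t - s) / 8) ^ 4 + 2 * ((t + s) / 8) ^ 4 := by
      nlinarith [sq_nonneg (((t - s) / 8) ^ 2 - ((t + s) / 8) ^ 2)]
    refine h3.trans ((add_le_add h1 h2).trans ?_)
    rw [Finset.sum_mul]
    simp_rw [Finset.sum_mul]
    refine le_trans (le_of_eq ?_) (Finset.sum_le_sum fun σ _ => Finset.sum_le_sum fun τ _ => hcs σ τ)
    simp [boolSign]
    ring

end Growth

/-! ### A finite family of swirls that amplifies gradients -/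

section Family

variable {d : ℕ}

local notation "E" => EuclideanSpace ℝ (Fin d)

/-- The midpoint of `p` and the point `q` obtained from `p` by replacing the coordinates
`i` and `j` by `1/2 + σ/4` and `1/2 + τ/4`. Half a turn in the `(i, j)` plane about it
exchanges `p` and `q`. -/
noncomputable def swirlCenter (i j : Fin d) (p : EuclideanSpace ℝ (Fin d)) (σ τ : ℝ) :
    EuclideanSpace ℝ (Fin d) :=
  WithLp.toLp 2 fun k =>
    if k = i then p i / 2 + 1 / 4 + σ / 8 else if k = j then p j / 2 + 1 / 4 + τ / 8 else p k

lemma swirlCenter_left (i j : Fin d) (p : E) (σ τ : ℝ) :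
    swirlCenter i j p σ τ i = p i / 2 + 1 / 4 + σ / 8 := by simp [swirlCenter]

lemma swirlCenter_right {i j : Fin d} (hij : i ≠ j) (p : E) (σ τ : ℝ) :
    swirlCenter i j p σ τ j = p j / 2 + 1 / 4 + τ / 8 := by simp [swirlCenter, hij.symm]

lemma swirlCenter_mem {i j : Fin d} {p : E} (hp : ∀ k, p k ∈ Icc (0 : ℝ) 1) {σ τ : ℝ}
    (hσ : σ ∈ Icc (-1 : ℝ) 1) (hτ : τ ∈ Icc (-1 : ℝ) 1) (k : Fin d) :
    swirlCenter i j p σ τ k ∈ Icc (0 : ℝ) 1 := by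
  have := hp i; have := hp j; have := hp k
  simp only [swirlCenter, mem_Icc] at *
  split_ifs <;> constructor <;> linarith

lemma norm_sq_sub_swirlCenter_lt {i j : Fin d} (hij : i ≠ j) {p y : E}
    (hp : ∀ k, p k ∈ Icc (0 : ℝ) 1) (hy : y ∈ openCube d 0 1) {σ τ : ℝ}
    (hσ : σ ∈ Icc (-1 : ℝ) 1) (hτ : τ ∈ Icc (-1 : ℝ) 1) :
    ‖planeGenerator i j (y - swirlCenter i j p σ τ)‖ ^ 2 < 2 := by
  have h1 := hp i; have h2 := hp j; have h3 := hy i; have h4 := hy j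
  simp only [mem_Icc, mem_Ioo] at h1 h2 h3 h4 hσ hτ
  rw [norm_sq_planeGenerator hij, PiLp.sub_apply, PiLp.sub_apply, swirlCenter_left,
    swirlCenter_right hij]
  have e1 : (y i - (p i / 2 + 1 / 4 + σ / 8)) ^ 2 < 1 := by
    rw [sq_lt_one_iff_abs_lt_one, abs_lt]; constructor <;> linarith
  have e2 : (y j - (p j / 2 + 1 / 4 + τ / 8)) ^ 2 < 1 := by
    rw [sq_lt_one_iff_abs_lt_one, abs_lt]; constructor <;> linarith
  linarith

/-- Rotation by an angle close to `π` is close to the point reflection. -/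
lemma abs_add_rotation_le {η x y : ℝ} (hη : |η| ≤ 1 / 16) (hx : |x| ≤ 1) (hy : |y| ≤ 1) :
    |(1 - Real.cos η) * x + Real.sin η * y| ≤ 1 / 8 := by
  have h1 : |1 - Real.cos η| ≤ 1 / 16 := by
    have h := Real.one_sub_sq_div_two_le_cos (x := η)
    have h' := Real.cos_le_one η
    have h2 : η ^ 2 ≤ (1 / 16) ^ 2 := sq_le_sq' (abs_le.1 hη).1 (abs_le.1 hη).2
    rw [abs_of_nonneg (by linarith)]
    norm_num at h2
    linarith
  have h2 : |Real.sin η| ≤ 1 / 16 := Real.abs_sin_le_abs.trans hη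
  calc _ ≤ |(1 - Real.cos η) * x| + |Real.sin η * y| := abs_add_le _ _
    _ ≤ 1 / 16 * 1 + 1 / 16 * 1 := by
      rw [abs_mul, abs_mul]
      gcongr
    _ = 1 / 8 := by norm_num

/-- The time-one map of the swirl brings the part of the unit cube close to `p` close to `q`, so
that it stays in the unit cube. -/
lemma flow_planarSwirl_mem {i j : Fin d} (hij : i ≠ j) (N φ : ℝ) {p y : E}
    (hp : ∀ k, p k ∈ Icc (0 : ℝ) 1) (hy : y ∈ openCube d 0 1)
    (hi : |y i - p i| ≤ 1 / 16) (hj : |y j - p j| ≤ 1 / 16) {σ τ : ℝ}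
    (hσ : σ ∈ Icc (-1 : ℝ) 1) (hτ : τ ∈ Icc (-1 : ℝ) 1) :
    (planarSwirl hij N φ (swirlCenter i j p σ τ)).flow 1 y ∈ openCube d 0 1 := by
  have h1 := hp i; have h2 := hp j; have h3 := hy i; have h4 := hy j
  have hspeed := speed_planarSwirl_eq hij N φ (swirlCenter_mem (i := i) (j := j) hp hσ hτ) hy
    (norm_sq_sub_swirlCenter_lt hij hp hy hσ hτ)
  have hci := swirlCenter_left i j p σ τ
  have hcj := swirlCenter_right hij p σ τ
  set c := swirlCenter i j p σ τ
  set η := 1 / 16 * Real.sin (N * ‖planeGenerator i j (y - c)‖ ^ 2 + φ) with hη_def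
  have hη : |η| ≤ 1 / 16 := by
    rw [hη_def, abs_mul, abs_of_nonneg (by norm_num : (0 : ℝ) ≤ 1 / 16)]
    linarith [Real.abs_sin_le_one (N * ‖planeGenerator i j (y - c)‖ ^ 2 + φ)]
  have hcos : Real.cos (Real.pi + η) = -Real.cos η := by rw [add_comm, Real.cos_add_pi]
  have hsin : Real.sin (Real.pi + η) = -Real.sin η := by rw [add_comm, Real.sin_add_pi]
  simp only [mem_Icc, mem_Ioo] at h1 h2 h3 h4 hσ hτ
  have hflow : (planarSwirl hij N φ c).flow 1 y = c + ((y - c) + -Real.sin η •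
      planeGenerator i j (y - c) + (1 + Real.cos η) •
        planeGenerator i j (planeGenerator i j (y - c))) := by
    rw [Swirl.flow, hspeed, one_mul, rodrigues_apply, swirlAngle, ← hη_def, hcos, hsin,
      sub_neg_eq_add]
    rfl
  have hzi : |y i - c i| ≤ 1 := by rw [hci, abs_le]; constructor <;> linarith
  have hzj : |y j - c j| ≤ 1 := by rw [hcj, abs_le]; constructor <;> linarith
  intro k
  rw [hflow]
  by_cases hki : k = i
  · subst hki
    have hrot := abs_le.1 (abs_add_rotation_le hη hzi hzj)
    have hi' := abs_le.1 hi
    simp only [PiLp.add_apply, PiLp.sub_apply, PiLp.smul_apply, smul_eq_mul,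
      planeGenerator_left hij, planeGenerator_right hij, mem_Ioo]
    constructor <;> linarith
  · by_cases hkj : k = j
    · subst hkj
      have hrot := abs_le.1 (abs_add_rotation_le (y := -(y i - c i)) hη hzj (by rwa [abs_neg]))
      have hj' := abs_le.1 hj
      simp only [PiLp.add_apply, PiLp.sub_apply, PiLp.smul_apply, smul_eq_mul,
        planeGenerator_left hij, planeGenerator_right hij, mem_Ioo]
      constructor <;> linarith
    · simpa [planeGenerator_other hki hkj] using hy k

/-- The swirls attached to a point `p` of the unit cube: one for each coordinate `j` (paired with
another coordinate `partner j`), each of four centres and each of four phases. -/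
noncomputable def cubeSwirl {partner : Fin d → Fin d} (hpartner : ∀ j, partner j ≠ j) (N : ℝ)
    (p : EuclideanSpace ℝ (Fin d)) (k : Fin d × Bool × Bool × Fin 4) : Swirl d :=
  planarSwirl (hpartner k.1) N ((k.2.2.2 : ℕ) * (Real.pi / 2))
    (swirlCenter (partner k.1) k.1 p (boolSign k.2.1) (boolSign k.2.2.1))

variable {partner : Fin d → Fin d} (hpartner : ∀ j, partner j ≠ j)

/-- Among the swirls attached to `p`, the squared lengths of the transformed gradients add up to at
least a multiple of `N²` times the original one. -/
lemma sum_norm_sq_cubeSwirl (N : ℝ) {p y : EuclideanSpace ℝ (Fin d)}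
    (hp : ∀ k, p k ∈ Icc (0 : ℝ) 1) (hy : y ∈ openCube d 0 1) (g : EuclideanSpace ℝ (Fin d)) :
    N ^ 2 / 2 ^ 15 * ‖g‖ ^ 2 ≤ ∑ k, ‖ContinuousLinearMap.adjoint
      (fderiv ℝ ((cubeSwirl hpartner N p k).flow (-1)) ((cubeSwirl hpartner N p k).flow 1 y)) g‖ ^ 2
      := by
  have hterm : ∀ (j : Fin d) (σ τ : Bool), 2 * (N / 8) ^ 2 *
      (((y (partner j) - p (partner j) / 2 - 1 / 4 - boolSign σ / 8) * g j -
        (y j - p j / 2 - 1 / 4 - boolSign τ / 8) * g (partner j)) ^ 2 *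
        ((y (partner j) - p (partner j) / 2 - 1 / 4 - boolSign σ / 8) ^ 2 +
          (y j - p j / 2 - 1 / 4 - boolSign τ / 8) ^ 2)) ≤
      ∑ m, ‖ContinuousLinearMap.adjoint
        (fderiv ℝ ((cubeSwirl hpartner N p (j, σ, τ, m)).flow (-1))
          ((cubeSwirl hpartner N p (j, σ, τ, m)).flow 1 y)) g‖ ^ 2 := by
    intro j σ τ
    have hij := hpartner j
    set i := partner j
    have hσ := boolSign_mem σ
    have hτ := boolSign_mem τ
    have hr := norm_sq_sub_swirlCenter_lt hij hp hy hσ hτ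
    have hc := swirlCenter_mem (i := i) (j := j) hp hσ hτ
    have hci := swirlCenter_left i j p (boolSign σ) (boolSign τ)
    have hcj := swirlCenter_right hij p (boolSign σ) (boolSign τ)
    have hm : ∀ m : Fin 4, ‖ContinuousLinearMap.adjoint
        (fderiv ℝ ((cubeSwirl hpartner N p (j, σ, τ, m)).flow (-1))
          ((cubeSwirl hpartner N p (j, σ, τ, m)).flow 1 y)) g‖ ^ 2 = _ := fun m =>
      congrArg (· ^ 2) ((cubeSwirl hpartner N p (j, σ, τ, m)).norm_adjoint_fderiv_flow
        (fderiv_speed_planarSwirl hij N ((m : ℕ) * (Real.pi / 2)) hc hy hr) g)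
    simp only [hm]
    change _ ≤ ∑ m : Fin 4, ‖g - inner ℝ g (planeGenerator i j
      (y - swirlCenter i j p (boolSign σ) (boolSign τ))) • _‖ ^ 2
    rw [sum_norm_sq_sub_cos_smul, norm_sq_planeGenerator hij, planeGenerator_left hij,
      planeGenerator_right hij, real_inner_comm, inner_planeGenerator, PiLp.sub_apply,
      PiLp.sub_apply, hci, hcj]
    have : 0 ≤ 4 * ‖g‖ ^ 2 := by positivity
    refine le_trans (le_of_eq ?_) (le_add_of_nonneg_left this)
    ring
  have hg : ‖g‖ ^ 2 ≤ ∑ j, (g (partner j) ^ 2 + g j ^ 2) := by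
    rw [EuclideanSpace.real_norm_sq_eq]
    exact Finset.sum_le_sum fun j _ => le_add_of_nonneg_left (sq_nonneg _)
  rw [Fintype.sum_prod_type]
  simp_rw [Fintype.sum_prod_type]
  calc N ^ 2 / 2 ^ 15 * ‖g‖ ^ 2 ≤ N ^ 2 / 2 ^ 15 * ∑ j, (g (partner j) ^ 2 + g j ^ 2) :=
        mul_le_mul_of_nonneg_left hg (by positivity)
    _ = ∑ j, 2 * (N / 8) ^ 2 * ((g (partner j) ^ 2 + g j ^ 2) / 1024) := by
        rw [Finset.mul_sum]
        exact Finset.sum_congr rfl fun j _ => by ring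
    _ ≤ _ := by
        refine Finset.sum_le_sum fun j _ => ?_
        refine (mul_le_mul_of_nonneg_left (sum_four_centers
          (y (partner j) - p (partner j) / 2 - 1 / 4) (y j - p j / 2 - 1 / 4) _ _)
          (by positivity)).trans ?_
        rw [Finset.mul_sum]
        simp_rw [Finset.mul_sum]
        exact Finset.sum_le_sum fun σ _ => Finset.sum_le_sum fun τ _ => hterm j σ τ

lemma enorm_sq_eq_ofReal (v : E) : ‖v‖ₑ ^ 2 = ENNReal.ofReal (‖v‖ ^ 2) := by
  rw [← ofReal_norm, ENNReal.ofReal_pow (norm_nonneg _)]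

lemma lintegral_le_gradL2Norm_comp_sq {f : E → ℝ} (h : MemH1loc f) (e : VolumePreservingDiffeo d)
    {D Ω : Set E} (hD : MapsTo e.toHomeo.symm D Ω) :
    ∫⁻ y in D, ‖ContinuousLinearMap.adjoint (fderiv ℝ e.toHomeo (e.toHomeo.symm y))
      (weakGrad f y)‖ₑ ^ 2 ≤ gradL2Norm (fun x => f (e.toHomeo x)) Ω ^ 2 := by
  rw [gradL2Norm_comp_sq h]
  exact lintegral_mono_set fun y hy => ⟨_, hD hy, e.toHomeo.apply_symm_apply y⟩

lemma aemeasurable_adjoint_fderiv {f : E → ℝ} (h : MemH1loc f) (e : VolumePreservingDiffeo d) :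
    AEMeasurable (fun y => ‖ContinuousLinearMap.adjoint
      (fderiv ℝ e.toHomeo (e.toHomeo.symm y)) (weakGrad f y)‖ₑ ^ 2) volume := by
  have hcont : Continuous fun y => ContinuousLinearMap.adjoint
      (fderiv ℝ e.toHomeo (e.toHomeo.symm y)) :=
    (LinearIsometryEquiv.continuous ContinuousLinearMap.adjoint).comp
      ((e.contDiff.continuous_fderiv (by simp)).comp e.toHomeo.symm.continuous)
  exact (Continuous.comp_aestronglyMeasurable₂ (g := fun (L : E →L[ℝ] E) v => L v)
    isBoundedBilinearMap_apply.continuous hcont.aestronglyMeasurable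
    h.weakGrad_memL2loc.aestronglyMeasurable).enorm.pow_const 2

lemma sum_gradL2Norm_cubeSwirl (N : ℝ) {p : EuclideanSpace ℝ (Fin d)}
    (hp : ∀ k, p k ∈ Icc (0 : ℝ) 1) {f : EuclideanSpace ℝ (Fin d) → ℝ} (hf : MemH1loc f) :
    ENNReal.ofReal (N ^ 2 / 2 ^ 15) *
        ∫⁻ y in openCube d 0 1 ∩ Metric.ball p (1 / 16), ‖weakGrad f y‖ₑ ^ 2 ≤
      ∑ k, gradL2Norm (fun x => f ((cubeSwirl hpartner N p k).flow (-1) x)) (openCube d 0 1) ^ 2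
      := by
  set D := openCube d 0 1 ∩ Metric.ball p (1 / 16)
  have hDm : MeasurableSet D := (isOpen_openCube 0 1).measurableSet.inter measurableSet_ball
  set e := fun k => (cubeSwirl hpartner N p k).toFlow.diffeo (-1)
  have hsymm : ∀ k y, (e k).toHomeo.symm y = (cubeSwirl hpartner N p k).flow 1 y := fun k y => by
    change (cubeSwirl hpartner N p k).flow (- -1) y = _
    rw [neg_neg]
  have hmaps : ∀ k, MapsTo (e k).toHomeo.symm D (openCube d 0 1) := fun k y hy => by
    rw [hsymm]
    have hcoord : ∀ l, |y l - p l| ≤ 1 / 16 := fun l => by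
      have h1 := PiLp.norm_apply_le (y - p) l
      rw [PiLp.sub_apply, Real.norm_eq_abs] at h1
      have h2 := mem_ball_iff_norm.1 hy.2
      linarith
    exact flow_planarSwirl_mem (hpartner k.1) N _ hp hy.1 (hcoord _) (hcoord _) (boolSign_mem _)
      (boolSign_mem _)
  calc ENNReal.ofReal (N ^ 2 / 2 ^ 15) * ∫⁻ y in D, ‖weakGrad f y‖ₑ ^ 2
      = ∫⁻ y in D, ENNReal.ofReal (N ^ 2 / 2 ^ 15) * ‖weakGrad f y‖ₑ ^ 2 :=
        (lintegral_const_mul' _ _ ENNReal.ofReal_ne_top).symm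
    _ ≤ ∫⁻ y in D, ∑ k, ‖ContinuousLinearMap.adjoint
        (fderiv ℝ (e k).toHomeo ((e k).toHomeo.symm y)) (weakGrad f y)‖ₑ ^ 2 := by
        refine setLIntegral_mono' hDm fun y hy => ?_
        have h := sum_norm_sq_cubeSwirl hpartner N hp hy.1 (weakGrad f y)
        simp_rw [enorm_sq_eq_ofReal, hsymm]
        rw [← ENNReal.ofReal_sum_of_nonneg fun _ _ => by positivity,
          ← ENNReal.ofReal_mul (by positivity)]
        exact ENNReal.ofReal_le_ofReal h
    _ = ∑ k, ∫⁻ y in D, ‖ContinuousLinearMap.adjoint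
        (fderiv ℝ (e k).toHomeo ((e k).toHomeo.symm y)) (weakGrad f y)‖ₑ ^ 2 :=
        lintegral_finsetSum' _ fun k _ => (aemeasurable_adjoint_fderiv hf (e k)).restrict
    _ ≤ _ := Finset.sum_le_sum fun k _ => lintegral_le_gradL2Norm_comp_sq hf (e k) (hmaps k)

/-- The closed cube `[a, b]^d`. -/
def closedCube (d : ℕ) (a b : ℝ) : Set (EuclideanSpace ℝ (Fin d)) := {x | ∀ k, x k ∈ Icc a b}

lemma isCompact_closedCube (a b : ℝ) : IsCompact (closedCube d a b) := by
  have : closedCube d a b = (EuclideanSpace.equiv (Fin d) ℝ).toHomeomorph ⁻¹'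
      (univ.pi fun _ => Icc a b) := by
    ext x
    simp only [mem_preimage, mem_univ_pi]
    rfl
  rw [this, Homeomorph.isCompact_preimage]
  exact isCompact_univ_pi fun _ => isCompact_Icc

/-- A finite family of swirls, one of which amplifies the gradient of any given function
on the unit cube by the factor `e^α` in unit time. -/
theorem exists_swirl_family (hd : 2 ≤ d) (α : ℝ) :
    ∃ (ι : Type) (_ : Fintype ι) (S : ι → Swirl d),
      (∀ k, ∀ x ∉ closedCube d (-2) 3, (S k).speed x = 0) ∧
      ∀ f : EuclideanSpace ℝ (Fin d) → ℝ, MemH1loc f → ∃ k,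
        ENNReal.ofReal (Real.exp α) * gradL2Norm f (openCube d 0 1) ≤
          gradL2Norm (fun x => f ((S k).flow (-1) x)) (openCube d 0 1) := by
  have hnt : Nontrivial (Fin d) := Fin.nontrivial_iff_two_le.2 hd
  choose partner hpartner using fun j : Fin d => exists_ne j
  obtain ⟨P, hPsub, hPfin, hPcov⟩ :=
    (isCompact_closedCube (d := d) 0 1).finite_cover_balls (e := 1 / 16) (by norm_num)
  have hPne : P.Nonempty := by
    have h0 : (0 : E) ∈ closedCube d 0 1 := fun k => by simp
    obtain ⟨p, hp, _⟩ := mem_iUnion₂.1 (hPcov h0)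
    exact ⟨p, hp⟩
  have := hPfin.fintype
  have := hPne.to_subtype
  have hne : Nonempty (P × Fin d × Bool × Bool × Fin 4) :=
    ⟨⟨Classical.arbitrary P, ⟨0, by omega⟩, true, true, 0⟩⟩
  set n : ℕ := Fintype.card (P × Fin d × Bool × Bool × Fin 4)
  -- the frequency that beats the number of swirls in the family
  obtain ⟨N, hN⟩ : ∃ N : ℝ, N ^ 2 / 2 ^ 15 = n * Real.exp α ^ 2 :=
    ⟨√(2 ^ 15 * (n * Real.exp α ^ 2)), by rw [Real.sq_sqrt (by positivity)]; ring⟩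
  refine ⟨P × Fin d × Bool × Bool × Fin 4, inferInstance,
    fun k => cubeSwirl hpartner N k.1 k.2, ?_, ?_⟩
  · intro k x hx
    by_contra hcon
    exact hx fun l => mem_of_speed_planarSwirl_ne_zero (hpartner k.2.1) N _
      (swirlCenter_mem (hPsub k.1.2) (boolSign_mem _) (boolSign_mem _)) hcon l
  · intro f hf
    set G := fun k : P × Fin d × Bool × Bool × Fin 4 =>
      gradL2Norm (fun x => f ((cubeSwirl hpartner N k.1 k.2).flow (-1) x)) (openCube d 0 1)
    have hsum : ENNReal.ofReal (N ^ 2 / 2 ^ 15) * gradL2Norm f (openCube d 0 1) ^ 2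
        ≤ ∑ k, G k ^ 2 := by
      have hcov : openCube d 0 1 ⊆ ⋃ p : P, openCube d 0 1 ∩ Metric.ball (p : E) (1 / 16) := by
        intro x hx
        obtain ⟨p, hp, hxp⟩ := mem_iUnion₂.1 (hPcov fun k => Ioo_subset_Icc_self (hx k))
        exact mem_iUnion.2 ⟨⟨p, hp⟩, hx, hxp⟩
      calc _ ≤ ENNReal.ofReal (N ^ 2 / 2 ^ 15) * ∑ p : P,
            ∫⁻ y in openCube d 0 1 ∩ Metric.ball (p : E) (1 / 16), ‖weakGrad f y‖ₑ ^ 2 := by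
            rw [gradL2Norm_sq]
            gcongr
            refine (lintegral_mono_set hcov).trans ((lintegral_iUnion_le _ _).trans ?_)
            rw [tsum_fintype]
        _ ≤ ∑ p : P, ∑ k, G (p, k) ^ 2 := by
            rw [Finset.mul_sum]
            exact Finset.sum_le_sum fun p _ =>
              sum_gradL2Norm_cubeSwirl hpartner N (hPsub p.2) hf
        _ = _ := (Fintype.sum_prod_type fun k => G k ^ 2).symm
    obtain ⟨k, _, hk⟩ := Finset.exists_max_image Finset.univ (fun k => G k ^ 2)
      Finset.univ_nonempty
    refine ⟨k, ?_⟩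
    have hmax : ∑ k, G k ^ 2 ≤ n * G k ^ 2 := by
      simpa [n] using Finset.sum_le_card_nsmul Finset.univ (fun k => G k ^ 2) (G k ^ 2) hk
    have hle := hsum.trans hmax
    rw [hN, ENNReal.ofReal_mul (by positivity), ENNReal.ofReal_natCast, mul_assoc,
      ENNReal.mul_le_mul_iff_right (Nat.cast_ne_zero.2 Fintype.card_ne_zero) (ENNReal.natCast_ne_top n),
      ENNReal.ofReal_pow (by positivity), ← mul_pow] at hle
    exact (ENNReal.pow_le_pow_left_iff two_ne_zero).1 hle

end Family

/-! ### Uniform bounds and conclusion -/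

section Bounds

variable {d : ℕ}

local notation "E" => EuclideanSpace ℝ (Fin d)

namespace Swirl

variable (S : Swirl d)

lemma tsupport_field_subset {B : Set E} (hBc : IsClosed B) (hB : ∀ x ∉ B, S.speed x = 0) :
    tsupport S.field ⊆ B := by
  refine closure_minimal (fun x hx => ?_) hBc
  by_contra hcon
  exact hx (by simp [field, hB x hcon])

lemma exists_C1Norm_le {B : Set E} (hBc : IsCompact B) (hB : ∀ x ∉ B, S.speed x = 0) :
    ∃ C : ℝ≥0, C1Norm S.field ≤ C := by
  have hc : HasCompactSupport S.field :=
    hBc.of_isClosed_subset (isClosed_tsupport _) (S.tsupport_field_subset hBc.isClosed hB)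
  obtain ⟨a, ha⟩ := S.contDiff_field.continuous.bounded_above_of_compact_support hc
  obtain ⟨b, hb⟩ := (S.contDiff_field.continuous_fderiv (by simp)).bounded_above_of_compact_support
    (hc.fderiv ℝ)
  refine ⟨a.toNNReal + b.toNNReal, ?_⟩
  rw [C1Norm, ENNReal.coe_add]
  refine add_le_add (iSup_le fun x => ?_) (iSup_le fun x => ?_)
  · rw [← ofReal_norm]; exact ENNReal.ofReal_le_ofReal (ha x)
  · rw [← ofReal_norm]; exact ENNReal.ofReal_le_ofReal (hb x)

lemma exists_norm_fderiv_flow_le {B : Set E} (hBc : IsCompact B) (hB : ∀ x ∉ B, S.speed x = 0) :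
    ∃ L : ℝ≥0, ∀ s ∈ Icc (0 : ℝ) 1, ∀ y v, ‖fderiv ℝ (S.flow s) y v‖ ≤ L * ‖v‖ := by
  have hc : HasCompactSupport S.speed := by
    refine hBc.of_isClosed_subset (isClosed_tsupport _) (closure_minimal (fun x hx => ?_)
      hBc.isClosed)
    by_contra hcon
    exact hx (hB x hcon)
  have hcont : Continuous fun y => (‖fderiv ℝ S.speed y‖ * ‖S.gen (y - S.center)‖ : ℝ) := by
    have := S.contDiff_speed.continuous_fderiv (by simp)
    fun_prop
  obtain ⟨a, ha⟩ := hcont.bounded_above_of_compact_support ((hc.fderiv ℝ).norm.mul_right)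
  refine ⟨1 + a.toNNReal, fun s hs y v => ?_⟩
  rw [(S.hasFDerivAt_flow s y).fderiv]
  have h1 := (Real.le_norm_self _).trans (ha y)
  have ha0 : 0 ≤ a := (norm_nonneg _).trans (ha y)
  calc _ = ‖v + (s * fderiv ℝ S.speed y v) • S.gen (y - S.center)‖ := by
        rw [ContinuousLinearMap.comp_apply, S.isGen.norm_rodrigues]; rfl
    _ ≤ ‖v‖ + |s| * |fderiv ℝ S.speed y v| * ‖S.gen (y - S.center)‖ := by
        refine (norm_add_le _ _).trans ?_
        rw [norm_smul, Real.norm_eq_abs, abs_mul]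
    _ ≤ ‖v‖ + 1 * (‖fderiv ℝ S.speed y‖ * ‖v‖) * ‖S.gen (y - S.center)‖ := by
        gcongr
        · rw [abs_of_nonneg hs.1]; exact hs.2
        · exact (fderiv ℝ S.speed y).le_opNorm v
    _ = (1 + ‖fderiv ℝ S.speed y‖ * ‖S.gen (y - S.center)‖) * ‖v‖ := by ring
    _ ≤ _ := by
        push_cast
        rw [Real.coe_toNNReal a ha0]
        gcongr

end Swirl

/-- Composition with a diffeomorphism whose inverse maps `Ω` into itself decreases the gradient norm
on `Ω` at most by a factor, a Lipschitz constant of the inverse. -/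
lemma gradL2Norm_le_comp {f : E → ℝ} (h : MemH1loc f) (e : VolumePreservingDiffeo d) {L : ℝ≥0}
    (hL : ∀ y v, ‖fderiv ℝ e.toHomeo.symm y v‖ ≤ L * ‖v‖) {Ω : Set E}
    (hΩ : MapsTo e.toHomeo.symm Ω Ω) :
    gradL2Norm f Ω ≤ L * gradL2Norm (fun x => f (e.toHomeo x)) Ω := by
  rw [← ENNReal.pow_le_pow_left_iff two_ne_zero, mul_pow]
  refine le_trans ?_ (mul_le_mul_right (lintegral_le_gradL2Norm_comp_sq h e hΩ) _)
  rw [gradL2Norm_sq, ← lintegral_const_mul' _ _ (by simp)]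
  refine lintegral_mono fun y => ?_
  rw [← mul_pow]
  refine pow_le_pow_left' ?_ 2
  set g := weakGrad f y
  set A := ContinuousLinearMap.adjoint (fderiv ℝ e.toHomeo (e.toHomeo.symm y)) g with hA
  have key : ‖g‖ ≤ L * ‖A‖ := by
    rcases (norm_nonneg g).eq_or_lt with h0 | h0
    · rw [← h0]; positivity
    · refine le_of_mul_le_mul_right ?_ h0
      calc ‖g‖ * ‖g‖ = inner ℝ g (fderiv ℝ e.toHomeo (e.toHomeo.symm y)
            (fderiv ℝ e.toHomeo.symm y g)) := by
            rw [e.fderiv_comp_symm, real_inner_self_eq_norm_mul_norm]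
        _ = inner ℝ A (fderiv ℝ e.toHomeo.symm y g) := by
            rw [hA, ContinuousLinearMap.adjoint_inner_left]
        _ ≤ ‖A‖ * (L * ‖g‖) := (real_inner_le_norm _ _).trans
            (mul_le_mul_of_nonneg_left (hL y g) (norm_nonneg _))
        _ = _ := by ring
  rw [← ofReal_norm, ← ofReal_norm, ← ENNReal.ofReal_coe_nnreal,
    ← ENNReal.ofReal_mul (NNReal.coe_nonneg L)]
  exact ENNReal.ofReal_le_ofReal key

lemma closedCube_subset_openCube : closedCube d (-2) 3 ⊆ openCube d (-3) 4 := fun x hx k =>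
  ⟨by linarith [(hx k).1], by linarith [(hx k).2]⟩

end Bounds

theorem proposition2p2 (d : ℕ) (hd : 2 ≤ d) (α : ℝ) (hα : 0 < α) :
    -- the constants depend only on `α` and `d`
    ∃ (C : ℝ≥0) (β : ℝ), ∀ θ₀ : EuclideanSpace ℝ (Fin d) → ℝ, MemH1loc θ₀ →
      ∃ u : ℝ → EuclideanSpace ℝ (Fin d) → EuclideanSpace ℝ (Fin d),
        IsPiecewiseConstantInTime u ∧
        (∀ t, 0 ≤ t → ContDiff ℝ 1 (u t) ∧ IsDivFree (u t) ∧
          tsupport (u t) ⊆ openCube d (-3) 4) ∧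
        (⨆ t ∈ Ici (0 : ℝ), C1Norm (u t)) ≤ C ∧
        -- there is a weak solution, continuous in time, ...
        ∃ θ : ℝ → EuclideanSpace ℝ (Fin d) → ℝ,
          IsWeakTransportSolution u θ₀ θ ∧ IsContinuousInL2loc θ ∧
          -- ... which is the only weak solution ...
          (∀ η : ℝ → EuclideanSpace ℝ (Fin d) → ℝ, IsWeakTransportSolution u θ₀ η →
            ∀ᵐ t ∂(volume.restrict (Ici (0 : ℝ))), η t =ᵐ[volume] θ t) ∧
          -- ... it stays in `H¹_loc`, and its gradient grows
          (∀ t, 0 ≤ t → MemH1loc (θ t)) ∧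
          (∀ n : ℕ, ENNReal.ofReal (Real.exp (α * n)) * gradL2Norm θ₀ (openCube d 0 1)
            ≤ gradL2Norm (θ n) (openCube d 0 1)) ∧
          (∀ t, 0 ≤ t → ENNReal.ofReal (Real.exp (α * t - β)) * gradL2Norm θ₀ (openCube d 0 1)
            ≤ gradL2Norm (θ t) (openCube d (-3) 4)) := by
  obtain ⟨ι, _, S, hS, hgrow⟩ := exists_swirl_family hd α
  have hBc : IsCompact (closedCube d (-2) 3) := isCompact_closedCube _ _
  choose C hC using fun k => (S k).exists_C1Norm_le hBc (hS k)
  choose L hL using fun k => (S k).exists_norm_fderiv_flow_le hBc (hS k)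
  set Λ : ℝ≥0 := 1 + ∑ k, L k
  have hLΛ : ∀ k, L k ≤ Λ := fun k =>
    (Finset.single_le_sum (fun _ _ => zero_le) (Finset.mem_univ k)).trans le_add_self
  have hΛ : 0 < Λ := add_pos_of_pos_of_nonneg one_pos zero_le
  -- `α` accounts for the growth that the last, incomplete time unit does not provide, and `log Λ`
  -- for the distortion of gradients during that time
  refine ⟨∑ k, C k, α + Real.log Λ, fun θ₀ hθ₀ => ?_⟩
  have : Nonempty ι := ⟨(hgrow θ₀ hθ₀).choose⟩
  choose! κ hκ using hgrow
  -- the swirl for `[n, n + 1)` is chosen according to the solution at time `n`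
  let f : ℕ → EuclideanSpace ℝ (Fin d) → ℝ := fun n =>
    Nat.rec θ₀ (fun _ f x => f ((S (κ f)).flow (-1) x)) n
  let Φ : ℕ → VolumePreservingFlow d := fun n => (S (κ (f n))).toFlow
  have hB : ∀ n t, ∀ x ∉ closedCube d (-2) 3, (Φ n).flow t x = x := fun n t x hx =>
    (S (κ (f n))).flow_of_speed_eq_zero (hS _ x hx) t
  have hf : ∀ n : ℕ, transported Φ θ₀ n = f n := fun n => by
    induction n with
    | zero => ext x; rw [Nat.cast_zero]; exact transported_zero x
    | succ n ih =>
      ext x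
      rw [transported_eq_flow (n := n) (by push_cast; simp), ih]
      push_cast
      rw [add_sub_cancel_left]
      rfl
  have hunit : ∀ n : ℕ, ENNReal.ofReal (Real.exp (α * n)) * gradL2Norm θ₀ (openCube d 0 1)
      ≤ gradL2Norm (transported Φ θ₀ n) (openCube d 0 1) := fun n => by
    induction n with
    | zero => rw [hf]; simp [f]
    | succ n ih =>
      have hmem := memH1loc_transported (Φ := Φ) hθ₀ n
      rw [hf] at ih hmem ⊢
      rw [show α * ((n + 1 : ℕ) : ℝ) = α + α * n by push_cast; ring, Real.exp_add,
        ENNReal.ofReal_mul (Real.exp_pos _).le, mul_assoc]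
      exact (mul_le_mul_right ih _).trans (hκ (f n) hmem)
  have hweak := isWeakTransportSolution_transported hBc hB hθ₀.1
  refine ⟨stepField Φ, isPiecewiseConstantInTime_stepField, fun t _ => ⟨?_, ?_, ?_⟩,
    iSup₂_le fun t _ => ?_, transported Φ θ₀, hweak, isContinuousInL2loc_transported hBc hB hθ₀.1,
    fun η hη => hweak.ae_eq hη, fun t _ => memH1loc_transported hθ₀ t, hunit, fun t ht => ?_⟩
  · exact (Φ _).contDiff_field.of_le (by simp)
  · exact (S _).isDivFree_field
  · exact ((S _).tsupport_field_subset hBc.isClosed (hS _)).trans closedCube_subset_openCube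
  · refine (hC _).trans (ENNReal.coe_le_coe.2 ?_)
    exact Finset.single_le_sum (f := C) (fun _ _ => zero_le) (Finset.mem_univ _)
  · set n := ⌊t⌋₊
    have hnt : (n : ℝ) ≤ t := Nat.floor_le ht
    have htn : t < n + 1 := Nat.lt_floor_add_one t
    have hdecay := gradL2Norm_le_comp (L := Λ) (Ω := openCube d (-3) 4)
      (memH1loc_transported (Φ := Φ) hθ₀ n) ((Φ n).diffeo (-(t - n))) (fun y v => ?_) ?_
    · have heq : (fun x => transported Φ θ₀ n (((Φ n).diffeo (-(t - n))).toHomeo x))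
          = transported Φ θ₀ t := by
        ext x
        rw [transported_eq_flow (t := t) ⟨hnt, htn.le⟩]
        rfl
      rw [heq] at hdecay
      have hsub : gradL2Norm (transported Φ θ₀ n) (openCube d 0 1) ≤
          gradL2Norm (transported Φ θ₀ n) (openCube d (-3) 4) :=
        eLpNorm_mono_measure _ (Measure.restrict_mono (fun x hx k =>
          ⟨by linarith [(hx k).1], by linarith [(hx k).2]⟩) le_rfl)
      have hchain := (hunit n).trans (hsub.trans hdecay)
      have hexp : Real.exp (α * t - (α + Real.log Λ)) ≤ (Λ : ℝ)⁻¹ * Real.exp (α * n) := by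
        rw [← Real.exp_log (inv_pos.2 (NNReal.coe_pos.2 hΛ)), ← Real.exp_add, Real.log_inv]
        refine Real.exp_le_exp.2 ?_
        nlinarith
      calc _ ≤ ENNReal.ofReal ((Λ : ℝ)⁻¹ * Real.exp (α * n)) * gradL2Norm θ₀ (openCube d 0 1) := by
            gcongr
        _ = (Λ : ℝ≥0∞)⁻¹ * (ENNReal.ofReal (Real.exp (α * n)) *
              gradL2Norm θ₀ (openCube d 0 1)) := by
            rw [ENNReal.ofReal_mul (by positivity), ENNReal.ofReal_inv_of_pos
              (NNReal.coe_pos.2 hΛ), ENNReal.ofReal_coe_nnreal, mul_assoc]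
        _ ≤ (Λ : ℝ≥0∞)⁻¹ * (Λ * gradL2Norm (transported Φ θ₀ t) (openCube d (-3) 4)) :=
            mul_le_mul_right hchain _
        _ = _ := by
            rw [← mul_assoc, ENNReal.inv_mul_cancel (by simpa using hΛ.ne') ENNReal.coe_ne_top,
              one_mul]
    · have h1 := hL (κ (f n)) (t - n) ⟨by linarith, by linarith⟩ y v
      have h2 : ((Φ n).diffeo (-(t - n))).toHomeo.symm = (S (κ (f n))).flow (t - n) := by
        change (S (κ (f n))).flow (- -(t - n)) = _
        rw [neg_neg]
      rw [h2]
      exact h1.trans (mul_le_mul_of_nonneg_right (NNReal.coe_le_coe.2 (hLΛ _)) (norm_nonneg _))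
    · intro x hx
      have h2 := VolumePreservingDiffeo.mapsTo_of_eq_self ((Φ n).diffeo (- -(t - n)))
        (fun y hy => hB n _ y hy) closedCube_subset_openCube
      exact h2 hx
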